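/- \textbf{Conventions.} A \emph{Boolean circuit} over a finite set $A$ of variables is an acyclic digraph whose nodes without incoming edges are labelled by elements of $A$ and whose other nodes are labelled by gates in $\{\wedge,\vee,\neg\}$, with a distinguished output node. A \emph{Boolean automata network} (BAN) $F$ on a finite set $S$ assigns to every $s\in S$ a local function $f_s:\mathbb{B}^S\to\mathbb{B}$. A \emph{module} $M$ on disjoint finite sets $S$ (automata) and $I$ (inputs) assigns to every $s\in S$ a local function $f_s:\mathbb{B}^{S\cup I}\to\mathbb{B}$. A variable $a$ \emph{influences} a Boolean function $f$ if there are two assignments that differ exactly at $a$ and on which $f$ takes different values. A module is \emph{acyclic} if the digraph on $S$ with an arc from $s$ to $t$ whenever $s$ influences $f_t$ has no directed cycle (loops included). A \emph{recursive wiring} is a partial function $\omega$ from $I$ to $S$; $\circlearrowright_\omega M$ is the module on $S$ and $I\setminus\mathrm{dom}(\omega)$ obtained from $M$ by substituting the variable $\omega(i)$ for $i$, for every $i\in\mathrm{dom}(\omega)$. Networks and modules are encoded by giving a Boolean circuit for each local function; integers such as $k$ are written in binary. The \emph{Acyclic Unfolding Functional Problem} is the following promise search problem. Input: a BAN $F$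 on $S$ and a natural number $k$. Promise: the encoding of $F$ has only essential variables, that is, for every $s\in S$, a variable appears in the circuit of $f_s$ if and only if it influences $f_s$. Output: an acyclic module $M$ on the same set $S$ of automata, with at most $k$ inputs, and a recursive wiring $\omega$ such that $\circlearrowright_\omega M=F$ (that is, no input is left and the local functions are the same). Its \emph{syntactic variant} has the same inputs and promise, and requires in addition that the circuits obtained from those of $M$ by the substitution of variables $\omega$ be literally the circuits of $F$. A promise search problem is in $\mathrm{FNP}$ if there are a relation $V$ on words that is decidable in deterministic polynomial time and a polynomial $p$ such that, for every instance $x$ that satisfies the promise: (i) every word $w$ with $|w|\le p(|x|)$ and $V(x,w)$ is the encoding of a solution of $x$; (ii) if $x$ has a solution, then there is a word $w$ with $|w|\le p(|x|)$ and $V(x,w)$. \textbf{Theorem.} The Acyclic Unfolding Functional Problem is in $\mathrm{FNP}$, and so is its syntactic variant. Moreover, every solution of the syntactic variant is a solution of the Acyclic Unfolding Functional Problem, and every instance that satisfies the promise and has a solution also has a solution of the syntactic variant. -/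

import Mathlib

/-! ### Boolean circuits -/

/-- A node of a Boolean circuit over the variables `A`: a node without incoming edges carries a
variable, every other node carries a gate together with the list of its predecessors. -/
inductive Gate (A : Type) : Type where
  | var (a : A)
  | conj (preds : List ℕ)
  | disj (preds : List ℕ)
  | neg (pred : ℕ)

namespace Gate

/-- A gate may stand at position `i` of a circuit if its predecessors exist, and all stand
before position `i`. -/
def WellFormedAt {A : Type} (i : ℕ) : Gate A → Prop
  | var _ => True
  | conj l => l ≠ [] ∧ ∀ j ∈ l, j < i
  | disj l => l ≠ [] ∧ ∀ j ∈ l, j < i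
  | neg j => j < i

/-- Value of a gate, given the assignment `x` of the variables and the list `v` of the values of
the preceding nodes. -/
def eval {A : Type} (x : A → Bool) (v : List Bool) : Gate A → Bool
  | var a => x a
  | conj l => l.all (fun j => v.getD j false)
  | disj l => l.any (fun j => v.getD j false)
  | neg j => !(v.getD j false)

/-- Renaming of the variables. -/
def rename {A B : Type} (g : A → B) : Gate A → Gate B
  | var a => var (g a)
  | conj l => conj l
  | disj l => disj l
  | neg j => neg j

theorem WellFormedAt.rename {A B : Type} (g : A → B) {i : ℕ} {G : Gate A}
    (h : G.WellFormedAt i) : (G.rename g).WellFormedAt i := by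
  cases G <;> exact h

end Gate

/-- A Boolean circuit over the variables `A`: an acyclic digraph, whose nodes are listed in a
topological order, with a distinguished output node. -/
structure Circuit (A : Type) : Type where
  gates : List (Gate A)
  output : ℕ
  wellFormed : ∀ (i : ℕ) (h : i < gates.length), (gates[i]).WellFormedAt i
  output_lt : output < gates.length

namespace Circuit

/-- The values of the nodes, computed in topological order. -/
def values {A : Type} (C : Circuit A) (x : A → Bool) : List Bool :=
  C.gates.foldl (fun v G => v ++ [G.eval x v]) []

/-- The Boolean function `(A → Bool) → Bool` computed by a circuit. -/
def eval {A : Type} (C : Circuit A) (x : A → Bool) : Bool :=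
  (C.values x).getD C.output false

/-- The variable `a` is included in the circuit. -/
def Occurs {A : Type} (C : Circuit A) (a : A) : Prop :=
  Gate.var a ∈ C.gates

/-- Substitution of variables by variables. -/
def rename {A B : Type} (g : A → B) (C : Circuit A) : Circuit B where
  gates := C.gates.map (Gate.rename g)
  output := C.output
  wellFormed := by
    intro i h
    rw [List.getElem_map]
    exact (C.wellFormed i (by simpa using h)).rename g
  output_lt := by simpa using C.output_lt

end Circuit

/-! ### Boolean automata networks, modules, wirings -/

/-- The variable `a` influences the function `f`: there are two assignments that differ exactly at
`a` and on which `f` takes different values. -/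
def Influences {A : Type} (f : (A → Bool) → Bool) (a : A) : Prop :=
  ∃ x x' : A → Bool, f x ≠ f x' ∧ ∀ r, r ≠ a ↔ x r = x' r

/-- A Boolean automata network on the set `S` of automata: a local function for each automaton. -/
abbrev BAN (S : Type) : Type := S → (S → Bool) → Bool

/-- A module on the set `S` of automata with the set `I` of inputs. -/
abbrev BoolModule (S I : Type) : Type := S → (S ⊕ I → Bool) → Bool

namespace BoolModule

/-- A module is acyclic if its interaction digraph (on the automata, with an arc from `s` to `t`
when `s` influences the local function of `t`) has no directed cycle; loops are cycles. Inputs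
have no incoming arcs. -/
def IsAcyclic {S I : Type} (M : BoolModule S I) : Prop :=
  ∀ s : S, ¬ Relation.TransGen (fun s t => Influences (M t) (Sum.inl s)) s s

/-- A module is equal to a network if it has no input and the same local functions. -/
def EqBAN {S J : Type} (N : BoolModule S J) (F : BAN S) : Prop :=
  IsEmpty J ∧ ∀ (s : S) (x : S ⊕ J → Bool), N s x = F s (fun t => x (Sum.inl t))

end BoolModule

/-- A recursive wiring: a partial function from the inputs to the automata. -/
abbrev Wiring (S I : Type) : Type := I → Option S

namespace Wiring

/-- The inputs outside the domain of the wiring. -/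
abbrev Free {S I : Type} (ω : Wiring S I) : Type := {i : I // ω i = none}

/-- The substitution `ω̂`, extended by the identity on the automata: `i` goes to `ω i` if it is in
the domain of `ω`, and to itself otherwise. -/
def subst {S I : Type} (ω : Wiring S I) : S ⊕ I → S ⊕ ω.Free
  | Sum.inl s => Sum.inl s
  | Sum.inr i =>
    match h : ω i with
    | some s => Sum.inl s
    | none => Sum.inr ⟨i, h⟩

/-- The module `↻_ω M`, on the automata `S` and the inputs `I ∖ dom ω`. -/
def apply {S I : Type} (ω : Wiring S I) (M : BoolModule S I) : BoolModule S ω.Free :=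
  fun s x => M s (fun v => x (ω.subst v))

end Wiring

/-- The encoding of a network on `{0, …, n-1}` by Boolean circuits. -/
abbrev BANCode (n : ℕ) : Type := Fin n → Circuit (Fin n)

/-- The encoding of a module with automata `{0, …, n-1}` and inputs `{0, …, m-1}` by circuits. -/
abbrev ModuleCode (n m : ℕ) : Type := Fin n → Circuit (Fin n ⊕ Fin m)

/-- The network described by a family of circuits. -/
def BANCode.toBAN {n : ℕ} (F : BANCode n) : BAN (Fin n) := fun s => (F s).eval

/-- The module described by a family of circuits. -/
def ModuleCode.toModule {n m : ℕ} (M : ModuleCode n m) : BoolModule (Fin n) (Fin m) :=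
  fun s => (M s).eval

/-- The encoding has only essential variables: a variable is included in the circuit of a local
function if and only if it influences that function. -/
def BANCode.Essential {n : ℕ} (F : BANCode n) : Prop :=
  ∀ s v : Fin n, (F s).Occurs v ↔ Influences (F.toBAN s) v

/-! ### Search problems with a promise, and the class FNP -/

/-- A search problem with a promise: instances and solutions are encoded by words over a finite
alphabet, and every instance has its own type of candidate solutions. -/
structure SearchProblem : Type 1 where
  Alphabet : Type
  finiteAlphabet : Finite Alphabet
  Instance : Type
  Candidate : Instance → Type
  encodeInstance : Instance → List Alphabet
  encodeInstance_injective : Function.Injective encodeInstance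
  encodeCandidate : (x : Instance) → Candidate x → List Alphabet
  encodeCandidate_injective : ∀ x, Function.Injective (encodeCandidate x)
  Promise : Instance → Prop
  IsSolution : (x : Instance) → Candidate x → Prop

/-- Encoding of a pair of words, with a separator. -/
def pairCode {Γ : Type} (uw : List Γ × List Γ) : List (Option Γ) :=
  uw.1.map some ++ none :: uw.2.map some

/-- A relation on words is decided by a Turing machine in polynomial time. -/
def PolyTimeDecides {Γ : Type} (V : List Γ × List Γ → Bool) : Prop :=
  Nonempty (Turing.TM2ComputableInPolyTime (pairCode (Γ := Γ)) Computability.encodeBool V)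

/-- The problem is in FNP: it is solved by guessing a word of polynomial length and checking it in
deterministic polynomial time. On each instance that satisfies the promise, every guess that is
accepted is (the encoding of) a solution, and some guess is accepted if there is a solution. -/
def SearchProblem.InFNP (P : SearchProblem) : Prop :=
  ∃ (V : List P.Alphabet × List P.Alphabet → Bool) (p : Polynomial ℕ),
    PolyTimeDecides V ∧
    ∀ x : P.Instance, P.Promise x →
      (∀ w : List P.Alphabet, w.length ≤ p.eval (P.encodeInstance x).length →
        V (P.encodeInstance x, w) = true →
        ∃ y : P.Candidate x, P.encodeCandidate x y = w ∧ P.IsSolution x y) ∧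
      ((∃ y : P.Candidate x, P.IsSolution x y) →
        ∃ w : List P.Alphabet, w.length ≤ p.eval (P.encodeInstance x).length ∧
          V (P.encodeInstance x, w) = true)

/-! ### Encoding of networks, modules and wirings by words

Names of nodes are written in unary; each of them is smaller than the length of a list that is
written out in the same word, so binary names would change lengths only polynomially. The integer
`k` of an instance is written in binary. -/

/-- The alphabet. -/
inductive Letter : Type where
  | tick | cons | nil | auto | inp | var | conj | disj | neg | bit (b : Bool)
  deriving DecidableEq, Fintype

/-- A prefix code: the encoded object and the rest can be recovered from the concatenation. -/
def PrefixCode {α : Type} (e : α → List Letter) : Prop :=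
  ∀ a b r s, e a ++ r = e b ++ s → a = b ∧ r = s

theorem PrefixCode.injective {α : Type} {e : α → List Letter} (h : PrefixCode e) :
    Function.Injective e := fun a b hab => (h a b [] [] (by rw [hab])).1

/-- Unary notation. -/
def encodeIdx : ℕ → List Letter
  | 0 => [Letter.nil]
  | j + 1 => Letter.tick :: encodeIdx j

theorem prefixCode_encodeIdx : PrefixCode encodeIdx := by
  intro a
  induction a with
  | zero => intro b r s h; cases b <;> simp_all [encodeIdx]
  | succ a ih =>
    intro b r s h
    cases b with
    | zero => simp [encodeIdx] at h
    | succ b =>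
      simp only [encodeIdx, List.cons_append, List.cons.injEq, true_and] at h
      obtain ⟨h1, h2⟩ := ih b r s h
      exact ⟨by rw [h1], h2⟩

/-- A list is written as `cons a₀ cons a₁ … nil`. -/
def encodeList {α : Type} (e : α → List Letter) : List α → List Letter
  | [] => [Letter.nil]
  | a :: l => Letter.cons :: (e a ++ encodeList e l)

theorem prefixCode_encodeList {α : Type} {e : α → List Letter} (he : PrefixCode e) :
    PrefixCode (encodeList e) := by
  intro a
  induction a with
  | nil => intro b r s h; cases b <;> simp_all [encodeList]
  | cons a l ih =>
    intro b r s h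
    cases b with
    | nil => simp [encodeList] at h
    | cons b l' =>
      simp only [encodeList, List.cons_append, List.cons.injEq, true_and, List.append_assoc] at h
      obtain ⟨h1, h2⟩ := he _ _ _ _ h
      obtain ⟨h3, h4⟩ := ih _ _ _ h2
      exact ⟨by rw [h1, h3], h4⟩

/-- An automaton. -/
def encodeFin {n : ℕ} (j : Fin n) : List Letter := Letter.auto :: encodeIdx j

theorem prefixCode_encodeFin {n : ℕ} : PrefixCode (encodeFin (n := n)) := by
  intro a b r s h
  simp only [encodeFin, List.cons_append, List.cons.injEq, true_and] at h
  obtain ⟨h1, h2⟩ := prefixCode_encodeIdx _ _ _ _ h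
  exact ⟨Fin.ext h1, h2⟩

/-- An automaton or an input. -/
def encodeSum {n m : ℕ} : Fin n ⊕ Fin m → List Letter
  | Sum.inl j => encodeFin j
  | Sum.inr i => Letter.inp :: encodeIdx i

theorem prefixCode_encodeSum {n m : ℕ} : PrefixCode (encodeSum (n := n) (m := m)) := by
  intro a b r s h
  rcases a with a | a <;> rcases b with b | b
  · obtain ⟨h1, h2⟩ := prefixCode_encodeFin _ _ _ _ h
    exact ⟨by rw [h1], h2⟩
  · simp [encodeSum, encodeFin] at h
  · simp [encodeSum, encodeFin] at h
  · simp only [encodeSum, List.cons_append, List.cons.injEq, true_and] at h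
    obtain ⟨h1, h2⟩ := prefixCode_encodeIdx _ _ _ _ h
    exact ⟨by rw [Fin.ext h1], h2⟩

/-- A value of a partial function. -/
def encodeOption {n : ℕ} : Option (Fin n) → List Letter
  | none => [Letter.nil]
  | some j => encodeFin j

theorem prefixCode_encodeOption {n : ℕ} : PrefixCode (encodeOption (n := n)) := by
  intro a b r s h
  rcases a with _ | a <;> rcases b with _ | b
  · simpa [encodeOption] using h
  · simp [encodeOption, encodeFin] at h
  · simp [encodeOption, encodeFin] at h
  · obtain ⟨h1, h2⟩ := prefixCode_encodeFin _ _ _ _ h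
    exact ⟨by rw [h1], h2⟩

/-- A node of a circuit; `e` encodes the variables. -/
def encodeGate {A : Type} (e : A → List Letter) : Gate A → List Letter
  | Gate.var a => Letter.var :: e a
  | Gate.conj l => Letter.conj :: encodeList encodeIdx l
  | Gate.disj l => Letter.disj :: encodeList encodeIdx l
  | Gate.neg j => Letter.neg :: encodeIdx j

theorem prefixCode_encodeGate {A : Type} {e : A → List Letter} (he : PrefixCode e) :
    PrefixCode (encodeGate e) := by
  intro a b r s h
  cases a <;> cases b <;>
    simp only [encodeGate, List.cons_append, List.cons.injEq, true_and, reduceCtorEq,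
      false_and] at h
  · obtain ⟨h1, h2⟩ := he _ _ _ _ h
    exact ⟨by rw [h1], h2⟩
  · obtain ⟨h1, h2⟩ := prefixCode_encodeList prefixCode_encodeIdx _ _ _ _ h
    exact ⟨by rw [h1], h2⟩
  · obtain ⟨h1, h2⟩ := prefixCode_encodeList prefixCode_encodeIdx _ _ _ _ h
    exact ⟨by rw [h1], h2⟩
  · obtain ⟨h1, h2⟩ := prefixCode_encodeIdx _ _ _ _ h
    exact ⟨by rw [h1], h2⟩

/-- A circuit: the list of its nodes, then the output node. -/
def encodeCircuit {A : Type} (e : A → List Letter) (C : Circuit A) : List Letter :=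
  encodeList (encodeGate e) C.gates ++ encodeIdx C.output

theorem prefixCode_encodeCircuit {A : Type} {e : A → List Letter} (he : PrefixCode e) :
    PrefixCode (encodeCircuit e) := by
  intro a b r s h
  obtain ⟨g, o, hg, ho⟩ := a
  obtain ⟨g', o', hg', ho'⟩ := b
  simp only [encodeCircuit, List.append_assoc] at h
  obtain ⟨h1, h2⟩ := prefixCode_encodeList (prefixCode_encodeGate he) _ _ _ _ h
  obtain ⟨h3, h4⟩ := prefixCode_encodeIdx _ _ _ _ h2
  subst h1 h3
  exact ⟨rfl, h4⟩

/-! ### The acyclic unfolding problem -/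

/-- An instance: a network, given by circuits, and an integer `k`. -/
structure UnfoldingInstance : Type where
  n : ℕ
  F : BANCode n
  k : ℕ

/-- A candidate for a network with `n` automata: a module on the same automata, given by circuits,
and a recursive wiring over it. -/
structure UnfoldingCandidate (n : ℕ) : Type where
  m : ℕ
  ω : Wiring (Fin n) (Fin m)
  M : ModuleCode n m

/-- The word of an instance: the number of automata, their circuits, then the binary notation
of `k`. -/
def UnfoldingInstance.encode (x : UnfoldingInstance) : List Letter :=
  encodeIdx x.n ++ (encodeList (encodeCircuit encodeFin) (List.ofFn x.F) ++
    (Computability.encodeNat x.k).map Letter.bit)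

theorem UnfoldingInstance.encode_injective : Function.Injective UnfoldingInstance.encode := by
  rintro ⟨n, F, k⟩ ⟨n', F', k'⟩ h
  obtain ⟨h0, h⟩ := prefixCode_encodeIdx _ _ _ _ h
  simp only at h0 h
  subst h0
  obtain ⟨h1, h2⟩ := prefixCode_encodeList (prefixCode_encodeCircuit prefixCode_encodeFin) _ _ _ _ h
  have h3 := List.map_injective_iff.2 (fun a b h => by simpa using h) h2
  have h4 : k = k' := by
    rw [← Computability.decode_encodeNat k, h3, Computability.decode_encodeNat]
  subst h4
  rw [List.ofFn_injective h1]

/-- The word of a candidate: the list of the values of the wiring at the inputs, then the circuits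
of the automata. -/
def UnfoldingCandidate.encode {n : ℕ} (y : UnfoldingCandidate n) : List Letter :=
  encodeList encodeOption (List.ofFn y.ω) ++
    encodeList (encodeCircuit encodeSum) (List.ofFn y.M)

theorem UnfoldingCandidate.encode_injective {n : ℕ} :
    Function.Injective (UnfoldingCandidate.encode (n := n)) := by
  rintro ⟨m, ω, M⟩ ⟨m', ω', M'⟩ h
  obtain ⟨h1, h2⟩ := prefixCode_encodeList prefixCode_encodeOption _ _ _ _ h
  simp only at h1 h2
  have hm : m = m' := by simpa using congrArg List.length h1
  subst hm
  have h3 := (prefixCode_encodeList (prefixCode_encodeCircuit prefixCode_encodeSum)).injective h2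
  rw [List.ofFn_injective h1, List.ofFn_injective h3]

/-- The Acyclic Unfolding Functional Problem: given a network `F`, encoded with essential variables
only, and an integer `k`, find an acyclic module `M` with at most `k` inputs and a recursive wiring
`ω` such that `↻_ω M = F`. -/
def acyclicUnfolding : SearchProblem where
  Alphabet := Letter
  finiteAlphabet := inferInstance
  Instance := UnfoldingInstance
  Candidate := fun x => UnfoldingCandidate x.n
  encodeInstance := UnfoldingInstance.encode
  encodeInstance_injective := UnfoldingInstance.encode_injective
  encodeCandidate := fun _ => UnfoldingCandidate.encode
  encodeCandidate_injective := fun _ => UnfoldingCandidate.encode_injective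
  Promise := fun x => x.F.Essential
  IsSolution := fun x y =>
    y.M.toModule.IsAcyclic ∧ y.m ≤ x.k ∧ (y.ω.apply y.M.toModule).EqBAN x.F.toBAN

/-- Syntactic equality `↻_ω M = F`: no input is left, and the substitution of variables given by
`ω` turns the circuits of `M` into the very circuits of `F`. -/
def SyntacticEq {n m : ℕ} (ω : Wiring (Fin n) (Fin m)) (M : ModuleCode n m) (F : BANCode n) :
    Prop :=
  IsEmpty ω.Free ∧ ∀ s : Fin n, (M s).rename ω.subst = (F s).rename Sum.inl

/-- The same problem, except that `↻_ω M` has to be equal to `F` syntactically. -/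
def syntacticAcyclicUnfolding : SearchProblem where
  Alphabet := Letter
  finiteAlphabet := inferInstance
  Instance := UnfoldingInstance
  Candidate := fun x => UnfoldingCandidate x.n
  encodeInstance := UnfoldingInstance.encode
  encodeInstance_injective := UnfoldingInstance.encode_injective
  encodeCandidate := fun _ => UnfoldingCandidate.encode
  encodeCandidate_injective := fun _ => UnfoldingCandidate.encode_injective
  Promise := fun x => x.F.Essential
  IsSolution := fun x y =>
    y.M.toModule.IsAcyclic ∧ y.m ≤ x.k ∧ SyntacticEq y.ω y.M x.F

/-!
The certificate of an instance is always of one canonical form, and it can be checked by syntactic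
means only; this is why one verifier serves both problems.

Let `F` be a network encoded by circuits, and let `ps` be a list of automata. Replace, in every
circuit of `F`, each variable that belongs to the list by a new input, one input for each member
of the list, and let the wiring send every input back to its automaton (`cut`). The wiring turns
the circuits of this module into the very circuits of `F`, and the module is acyclic as soon as the
members of the list meet all cycles of the digraph of variable occurrences. Conversely, let `M` and
`ω` be any solution, and let `ps` be the image of `ω`. If an automaton `s` outside the image
influences a local function of `F`, then it already influences that local function of `M`. When
all variables of the circuits of `F` are essential, occurrences are influences, so `ps` meets all
cycles of occurrences, and it has at most as many members as `M` has inputs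
(`exists_cut_of_eqBAN`). Hence an instance that satisfies the promise has a solution if and only if
there is a list of at most `k` automata that meets all cycles of occurrences, and then the module
cut at this list is a solution even syntactically.

The verifier thus reads a strictly increasing list of automata, rewrites the circuits of the
instance and compares the result with the rest of the certificate, letter by letter, compares the
length of the list with the binary number `k`, and tests acyclicity: an automaton is marked if it
belongs to the list or if all variables of its circuit were marked before, and this is repeated
often enough to reach a fixed point. Acyclicity means that all automata end up marked
(`not_transGen_arc`, `getD_iterate_of_acyclic`).

That the verifier runs in polynomial time on a Turing machine is proved once and for all for a
small structured language of stack programs (`Cmd`), in which the body of a loop is run as many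
times as the input is long. `Cmd.polyTimeDecides` compiles such a program to a machine with
finitely many stacks. Each loop gets two unary counters, and a polynomial bound for the number of
steps is read off from the program.
-/

/-! ### A structured language of stack programs -/

/-- Programs over stacks indexed by `R` with symbols in `Γ`, and a control state in `σ`. The body
of `loop` is run `N` times, where `N` is the length of the input of the whole program: the running
time is then bounded by a polynomial in `N` that is read off from the program. -/
inductive Cmd (σ R Γ : Type) : Type where
  | push (r : R) (f : σ → Γ)
  | pop (r : R) (f : σ → Option Γ → σ)
  | load (f : σ → σ)
  | ite (p : σ → Bool) (c d : Cmd σ R Γ)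
  | seq (c d : Cmd σ R Γ)
  | loop (c : Cmd σ R Γ)

namespace Cmd

variable {σ R Γ : Type}

/-- The effect of a program on the control state and on the stacks. -/
def eval [DecidableEq R] (N : ℕ) : Cmd σ R Γ → σ × (R → List Γ) → σ × (R → List Γ)
  | push r f, s => (s.1, Function.update s.2 r (f s.1 :: s.2 r))
  | pop r f, s => (f s.1 (s.2 r).head?, Function.update s.2 r (s.2 r).tail)
  | load f, s => (f s.1, s.2)
  | ite p c d, s => bif p s.1 then c.eval N s else d.eval N s
  | seq c d, s => d.eval N (c.eval N s)
  | loop c, s => (c.eval N)^[N] s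

/-- Nesting depth of the loops. -/
def depth : Cmd σ R Γ → ℕ
  | push _ _ => 0
  | pop _ _ => 0
  | load _ => 0
  | ite _ c d => max c.depth d.depth
  | seq c d => max c.depth d.depth
  | loop c => c.depth + 1

/-- A bound on the number of steps of the compiled program, as a polynomial in the number of
iterations of the loops. -/
noncomputable def cost : Cmd σ R Γ → Polynomial ℕ
  | push _ _ => 0
  | pop _ _ => 0
  | load _ => 0
  | ite _ c d => c.cost + d.cost
  | seq c d => c.cost + d.cost
  | loop c => Polynomial.X * (c.cost + 1) + 1 + (Polynomial.X + 1)

/-- A bound on the number of symbols pushed on a stack. -/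
noncomputable def growth : Cmd σ R Γ → Polynomial ℕ
  | push _ _ => 1
  | pop _ _ => 0
  | load _ => 0
  | ite _ c d => c.growth + d.growth
  | seq c d => c.growth + d.growth
  | loop c => Polynomial.X * c.growth

/-- The labels of the compiled program: two for every loop. -/
def Label : Cmd σ R Γ → Type
  | push _ _ => Empty
  | pop _ _ => Empty
  | load _ => Empty
  | ite _ c d => c.Label ⊕ d.Label
  | seq c d => c.Label ⊕ d.Label
  | loop c => Bool ⊕ c.Label

/-- Every program has finitely many labels. -/
@[reducible]
def fintypeLabel : (c : Cmd σ R Γ) → Fintype c.Label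
  | push _ _ => inferInstanceAs (Fintype Empty)
  | pop _ _ => inferInstanceAs (Fintype Empty)
  | load _ => inferInstanceAs (Fintype Empty)
  | ite _ c d => @instFintypeSum _ _ c.fintypeLabel d.fintypeLabel
  | seq c d => @instFintypeSum _ _ c.fintypeLabel d.fintypeLabel
  | loop c => @instFintypeSum _ _ _ c.fintypeLabel

/-- The stacks of the compiled program: an output stack, the stacks of the program, and two
stacks for every nesting level of loops, which count the iterations done and left. -/
inductive Stack (R : Type) (D : ℕ) : Type where
  | out
  | reg (r : R)
  | clk (i : Fin D)
  | aux (i : Fin D)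
  deriving DecidableEq, Fintype

/-- The symbols on the stacks of the compiled program. -/
@[reducible] def Symb (R Γ : Type) (D : ℕ) : Stack R D → Type
  | Stack.out => Bool
  | Stack.reg _ => Γ
  | Stack.clk _ => Unit
  | Stack.aux _ => Unit

/-- Contents of the stacks of the compiled program. -/
def conf {D : ℕ} (S : R → List Γ) (A B : Fin D → ℕ) : (k : Stack R D) → List (Symb R Γ D k)
  | Stack.out => []
  | Stack.reg r => S r
  | Stack.clk i => List.replicate (A i) ()
  | Stack.aux i => List.replicate (B i) ()

section conf
variable [DecidableEq R] {D : ℕ} (S : R → List Γ) (A B : Fin D → ℕ)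

theorem update_conf_reg (r : R) (l : List Γ) :
    Function.update (conf S A B) (Stack.reg r) l = conf (Function.update S r l) A B := by
  funext k
  rcases k with _ | q | i | i
  · simp [conf]
  · by_cases h : q = r
    · subst h; simp [conf]
    · rw [Function.update_of_ne (by simpa using h)]; simp [conf, h]
  · simp [conf]
  · simp [conf]

theorem update_conf_clk (i : Fin D) (n : ℕ) :
    Function.update (conf S A B) (Stack.clk i) (List.replicate n ()) =
      conf S (Function.update A i n) B := by
  funext k
  rcases k with _ | q | j | j
  · simp [conf]
  · simp [conf]
  · by_cases h : j = i
    · subst h; simp [conf]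
    · rw [Function.update_of_ne (by simpa using h)]; simp [conf, h]
  · simp [conf]

theorem update_conf_aux (i : Fin D) (n : ℕ) :
    Function.update (conf S A B) (Stack.aux i) (List.replicate n ()) =
      conf S A (Function.update B i n) := by
  funext k
  rcases k with _ | q | j | j
  · simp [conf]
  · simp [conf]
  · simp [conf]
  · by_cases h : j = i
    · subst h; simp [conf]
    · rw [Function.update_of_ne (by simpa using h)]; simp [conf, h]

end conf

/-- Statements of the compiled program; the boolean in the state is a scratch bit. -/
abbrev MStmt (σ R Γ : Type) (D : ℕ) (Λ : Type) : Type :=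
  Turing.TM2.Stmt (Symb R Γ D) Λ (σ × Bool)

/-- The statement that runs a program and continues with the statement `K`. -/
def entry {D : ℕ} {Λ : Type} :
    (c : Cmd σ R Γ) → c.depth ≤ D → (c.Label → Λ) → MStmt σ R Γ D Λ → MStmt σ R Γ D Λ
  | push r f, _, _, K => .push (Stack.reg r) (fun v => f v.1) K
  | pop r f, _, _, K => .pop (Stack.reg r) (fun v o => (f v.1 o, v.2)) K
  | load f, _, _, K => .load (fun v => (f v.1, v.2)) K
  | ite p c d, h, e, K =>
    .branch (fun v => p v.1)
      (c.entry ((le_max_left _ _).trans h) (fun l => e (Sum.inl l)) K)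
      (d.entry ((le_max_right _ _).trans h) (fun l => e (Sum.inr l)) K)
  | seq c d, h, e, K =>
    c.entry ((le_max_left _ _).trans h) (fun l => e (Sum.inl l))
      (d.entry ((le_max_right _ _).trans h) (fun l => e (Sum.inr l)) K)
  | loop _, _, e, _ => .goto (fun _ => e (Sum.inl false))

/-- The statements at the labels of a program. A loop moves its clock to the auxiliary stack, one
symbol for every iteration, and finally moves it back. -/
def code {D : ℕ} {Λ : Type} :
    (c : Cmd σ R Γ) → c.depth ≤ D → (c.Label → Λ) → MStmt σ R Γ D Λ → c.Label → MStmt σ R Γ D Λ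
  | push _ _, _, _, _ => fun l => nomatch (l : Empty)
  | pop _ _, _, _, _ => fun l => nomatch (l : Empty)
  | load _, _, _, _ => fun l => nomatch (l : Empty)
  | ite _ c d, h, e, K => fun l =>
    match (l : c.Label ⊕ d.Label) with
    | Sum.inl l => c.code ((le_max_left _ _).trans h) (fun l => e (Sum.inl l)) K l
    | Sum.inr l => d.code ((le_max_right _ _).trans h) (fun l => e (Sum.inr l)) K l
  | seq c d, h, e, K => fun l =>
    match (l : c.Label ⊕ d.Label) with
    | Sum.inl l => c.code ((le_max_left _ _).trans h) (fun l => e (Sum.inl l))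
        (d.entry ((le_max_right _ _).trans h) (fun l => e (Sum.inr l)) K) l
    | Sum.inr l => d.code ((le_max_right _ _).trans h) (fun l => e (Sum.inr l)) K l
  | loop c, h, e, K => fun l =>
    match (l : Bool ⊕ c.Label) with
    | Sum.inl false =>
      .pop (Stack.clk ⟨c.depth, h⟩) (fun v o => (v.1, o.isSome))
        (.branch (fun v => v.2)
          (.push (Stack.aux ⟨c.depth, h⟩) (fun _ => ())
            (c.entry (Nat.le_of_succ_le h) (fun l => e (Sum.inr l))
              (.goto fun _ => e (Sum.inl false))))
          (.goto fun _ => e (Sum.inl true)))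
    | Sum.inl true =>
      .pop (Stack.aux ⟨c.depth, h⟩) (fun v o => (v.1, o.isSome))
        (.branch (fun v => v.2)
          (.push (Stack.clk ⟨c.depth, h⟩) (fun _ => ()) (.goto fun _ => e (Sum.inl true))) K)
    | Sum.inr l =>
      c.code (Nat.le_of_succ_le h) (fun l => e (Sum.inr l)) (.goto fun _ => e (Sum.inl false)) l

/-- The configuration `b` is reached from the configuration `a` in at most `m` steps. -/
def RunsIn {K Λ τ : Type} {G : K → Type} [DecidableEq K] (M : Λ → Turing.TM2.Stmt G Λ τ) (m : ℕ)
    (a b : Turing.TM2.Cfg G Λ τ) : Prop :=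
  Nonempty (StateTransition.EvalsToInTime (Turing.TM2.step M) a (some b) m)

section RunsIn
variable {K Λ τ : Type} {G : K → Type} [DecidableEq K] {M : Λ → Turing.TM2.Stmt G Λ τ}

theorem RunsIn.refl (a : Turing.TM2.Cfg G Λ τ) : RunsIn M 0 a a :=
  ⟨StateTransition.EvalsToInTime.refl _ _⟩

theorem RunsIn.trans {m n : ℕ} {a b c : Turing.TM2.Cfg G Λ τ} (h : RunsIn M m a b)
    (h' : RunsIn M n b c) : RunsIn M (m + n) a c := by
  obtain ⟨h⟩ := h
  obtain ⟨h'⟩ := h'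
  rw [add_comm]
  exact ⟨StateTransition.EvalsToInTime.trans _ _ _ _ _ _ h h'⟩

theorem RunsIn.mono {m n : ℕ} {a b : Turing.TM2.Cfg G Λ τ} (h : RunsIn M m a b) (hmn : m ≤ n) :
    RunsIn M n a b := by
  obtain ⟨h⟩ := h
  exact ⟨⟨h.toEvalsTo, h.steps_le_m.trans hmn⟩⟩

theorem RunsIn.step (l : Λ) (v : τ) (S : ∀ k, List (G k)) :
    RunsIn M 1 ⟨some l, v, S⟩ (Turing.TM2.stepAux (M l) v S) :=
  ⟨⟨⟨1, rfl⟩, le_rfl⟩⟩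

end RunsIn

open Turing.TM2 in
/-- Correctness and running time of the compiled program. The clocks of all levels that occur in the
program have to be wound up before, and they are so again afterwards. Straight-line parts cost
nothing, since a statement is executed in the same step as the one before it. -/
theorem runsIn_entry [DecidableEq R] {D : ℕ} {Λ : Type} (M : Λ → MStmt σ R Γ D Λ) (N : ℕ)
    (c : Cmd σ R Γ) (h : c.depth ≤ D) (e : c.Label → Λ) (K : MStmt σ R Γ D Λ)
    (hM : ∀ l, M (e l) = c.code h e K l) (v : σ) (b : Bool) (S : R → List Γ) (A B : Fin D → ℕ)
    (hA : ∀ i : Fin D, i < c.depth → A i = N ∧ B i = 0) :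
    ∃ b', RunsIn M (c.cost.eval N) (stepAux (c.entry h e K) (v, b) (conf S A B))
      (stepAux K ((c.eval N (v, S)).1, b') (conf (c.eval N (v, S)).2 A B)) := by
  induction c generalizing K v b S A B with
  | push r f =>
    refine ⟨b, ?_⟩
    simp only [entry, stepAux, eval, cost, Polynomial.eval_zero]
    rw [update_conf_reg]
    exact RunsIn.refl _
  | pop r f =>
    refine ⟨b, ?_⟩
    simp only [entry, stepAux, eval, cost, Polynomial.eval_zero]
    rw [update_conf_reg]
    exact RunsIn.refl _
  | load f =>
    refine ⟨b, ?_⟩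
    simp only [entry, stepAux, eval, cost, Polynomial.eval_zero]
    exact RunsIn.refl _
  | ite p c d ihc ihd =>
    simp only [entry, stepAux, eval, cost, Polynomial.eval_add]
    cases hp : p v with
    | true =>
      obtain ⟨b', hb⟩ := ihc ((le_max_left _ _).trans h) (fun l => e (Sum.inl l)) K
        (fun l => hM (Sum.inl l)) v b S A B (fun i hi => hA i (lt_max_of_lt_left hi))
      exact ⟨b', hb.mono (Nat.le_add_right _ _)⟩
    | false =>
      obtain ⟨b', hb⟩ := ihd ((le_max_right _ _).trans h) (fun l => e (Sum.inr l)) K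
        (fun l => hM (Sum.inr l)) v b S A B (fun i hi => hA i (lt_max_of_lt_right hi))
      exact ⟨b', hb.mono (Nat.le_add_left _ _)⟩
  | seq c d ihc ihd =>
    simp only [entry, eval, cost, Polynomial.eval_add]
    obtain ⟨b', hb⟩ := ihc ((le_max_left _ _).trans h) (fun l => e (Sum.inl l)) _
        (fun l => hM (Sum.inl l)) v b S A B (fun i hi => hA i (lt_max_of_lt_left hi))
    obtain ⟨b'', hb'⟩ := ihd ((le_max_right _ _).trans h) (fun l => e (Sum.inr l)) K
        (fun l => hM (Sum.inr l)) (c.eval N (v, S)).1 b' (c.eval N (v, S)).2 A B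
        (fun i hi => hA i (lt_max_of_lt_right hi))
    exact ⟨b'', hb.trans hb'⟩
  | loop c ih =>
    have hc := hA ⟨c.depth, h⟩ (Nat.lt_succ_self _)
    have hhead := hM (Sum.inl false)
    have htail := hM (Sum.inl true)
    -- the first phase: `n` iterations are left
    have phase : ∀ n m : ℕ, ∀ v b S, ∃ b', RunsIn M (n * (c.cost.eval N + 1) + 1)
        ⟨some (e (Sum.inl false)), (v, b), conf S (Function.update A ⟨c.depth, h⟩ n)
          (Function.update B ⟨c.depth, h⟩ m)⟩
        ⟨some (e (Sum.inl true)), (((c.eval N)^[n] (v, S)).1, b'),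
          conf ((c.eval N)^[n] (v, S)).2 (Function.update A ⟨c.depth, h⟩ 0)
          (Function.update B ⟨c.depth, h⟩ (m + n))⟩ := by
      intro n
      induction n with
      | zero =>
        intro m v b S
        refine ⟨false, ?_⟩
        have := RunsIn.step (M := M) (e (Sum.inl false)) (v, b)
          (conf S (Function.update A ⟨c.depth, h⟩ 0) (Function.update B ⟨c.depth, h⟩ m))
        rw [hhead] at this
        have e0 := update_conf_clk S (Function.update A ⟨c.depth, h⟩ 0)
          (Function.update B ⟨c.depth, h⟩ m) ⟨c.depth, h⟩ 0
        rw [List.replicate_zero, Function.update_idem] at e0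
        simpa [code, conf, e0] using this
      | succ n ihn =>
        intro m v b S
        have h1 := RunsIn.step (M := M) (e (Sum.inl false)) (v, b)
          (conf S (Function.update A ⟨c.depth, h⟩ (n + 1)) (Function.update B ⟨c.depth, h⟩ m))
        rw [hhead] at h1
        have e1 : Function.update (conf S (Function.update A ⟨c.depth, h⟩ (n + 1))
            (Function.update B ⟨c.depth, h⟩ m)) (Stack.clk ⟨c.depth, h⟩) (List.replicate n ()) =
            conf S (Function.update A ⟨c.depth, h⟩ n) (Function.update B ⟨c.depth, h⟩ m) := by
          rw [update_conf_clk, Function.update_idem]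
        have e2 : Function.update (conf S (Function.update A ⟨c.depth, h⟩ n)
            (Function.update B ⟨c.depth, h⟩ m)) (Stack.aux ⟨c.depth, h⟩)
            (() :: List.replicate m ()) =
            conf S (Function.update A ⟨c.depth, h⟩ n)
              (Function.update B ⟨c.depth, h⟩ (m + 1)) := by
          rw [← List.replicate_succ, update_conf_aux, Function.update_idem]
        have e3 : conf S (Function.update A ⟨c.depth, h⟩ (n + 1))
            (Function.update B ⟨c.depth, h⟩ m) (Stack.clk ⟨c.depth, h⟩) =
              List.replicate (n + 1) () := by simp [conf]
        have e4 : conf S (Function.update A ⟨c.depth, h⟩ n)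
            (Function.update B ⟨c.depth, h⟩ m) (Stack.aux ⟨c.depth, h⟩) =
              List.replicate m () := by simp [conf]
        simp only [code, stepAux, e3, List.replicate_succ, List.head?_cons, Option.isSome_some,
          List.tail_cons, e1, e4, e2, cond_true] at h1
        obtain ⟨b1, h2⟩ := ih (Nat.le_of_succ_le h) (fun l => e (Sum.inr l)) _
          (fun l => hM (Sum.inr l)) v true S (Function.update A ⟨c.depth, h⟩ n)
          (Function.update B ⟨c.depth, h⟩ (m + 1)) (by
            intro i hi
            have hne : i ≠ ⟨c.depth, h⟩ := fun hh => by rw [hh] at hi; exact lt_irrefl _ hi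
            rw [Function.update_of_ne hne, Function.update_of_ne hne]
            exact hA i (Nat.lt_succ_of_lt hi))
        obtain ⟨b2, h3⟩ := ihn (m + 1) (c.eval N (v, S)).1 b1 (c.eval N (v, S)).2
        rw [Function.iterate_succ_apply, show m + (n + 1) = m + 1 + n by ring]
        exact ⟨b2, ((h1.trans h2).trans h3).mono (by ring_nf; rfl)⟩
    -- the second phase: the clock is restored
    have restore : ∀ m n : ℕ, ∀ v b S, RunsIn M (m + 1)
        ⟨some (e (Sum.inl true)), (v, b), conf S (Function.update A ⟨c.depth, h⟩ n)
          (Function.update B ⟨c.depth, h⟩ m)⟩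
        (stepAux K (v, false) (conf S (Function.update A ⟨c.depth, h⟩ (n + m))
          (Function.update B ⟨c.depth, h⟩ 0))) := by
      intro m
      induction m with
      | zero =>
        intro n v b S
        have := RunsIn.step (M := M) (e (Sum.inl true)) (v, b)
          (conf S (Function.update A ⟨c.depth, h⟩ n) (Function.update B ⟨c.depth, h⟩ 0))
        rw [htail] at this
        have e0 := update_conf_aux S (Function.update A ⟨c.depth, h⟩ n)
          (Function.update B ⟨c.depth, h⟩ 0) ⟨c.depth, h⟩ 0
        rw [List.replicate_zero, Function.update_idem] at e0
        simpa [code, conf, e0] using this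
      | succ m ihm =>
        intro n v b S
        have h1 := RunsIn.step (M := M) (e (Sum.inl true)) (v, b)
          (conf S (Function.update A ⟨c.depth, h⟩ n) (Function.update B ⟨c.depth, h⟩ (m + 1)))
        rw [htail] at h1
        have e1 : Function.update (conf S (Function.update A ⟨c.depth, h⟩ n)
            (Function.update B ⟨c.depth, h⟩ (m + 1))) (Stack.aux ⟨c.depth, h⟩)
            (List.replicate m ()) =
            conf S (Function.update A ⟨c.depth, h⟩ n) (Function.update B ⟨c.depth, h⟩ m) := by
          rw [update_conf_aux, Function.update_idem]
        have e2 : Function.update (conf S (Function.update A ⟨c.depth, h⟩ n)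
            (Function.update B ⟨c.depth, h⟩ m)) (Stack.clk ⟨c.depth, h⟩)
            (() :: List.replicate n ()) =
            conf S (Function.update A ⟨c.depth, h⟩ (n + 1))
              (Function.update B ⟨c.depth, h⟩ m) := by
          rw [← List.replicate_succ, update_conf_clk, Function.update_idem]
        have e3 : conf S (Function.update A ⟨c.depth, h⟩ n)
            (Function.update B ⟨c.depth, h⟩ (m + 1)) (Stack.aux ⟨c.depth, h⟩) =
              List.replicate (m + 1) () := by simp [conf]
        have e4 : conf S (Function.update A ⟨c.depth, h⟩ n)
            (Function.update B ⟨c.depth, h⟩ m) (Stack.clk ⟨c.depth, h⟩) =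
              List.replicate n () := by simp [conf]
        simp only [code, stepAux, e3, List.replicate_succ, List.head?_cons, Option.isSome_some,
          List.tail_cons, e1, e4, e2, cond_true] at h1
        have := (h1.trans (ihm (n + 1) v true S)).mono (show 1 + (m + 1) ≤ m + 1 + 1 by omega)
        rwa [show n + 1 + m = n + (m + 1) by ring] at this
    obtain ⟨b1, h1⟩ := phase N 0 v b S
    have h2 := restore N 0 ((c.eval N)^[N] (v, S)).1 b1 ((c.eval N)^[N] (v, S)).2
    have eA : Function.update A ⟨c.depth, h⟩ N = A := by rw [← hc.1, Function.update_eq_self]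
    have eB : Function.update B ⟨c.depth, h⟩ 0 = B := by
      rw [← hc.2, Function.update_eq_self]
    refine ⟨false, ?_⟩
    rw [eA, eB] at h1
    rw [zero_add] at h1 h2
    rw [eA, eB] at h2
    simpa [entry, eval, cost] using h1.trans h2

/-- The stacks grow at most by the number of push instructions that are executed. -/
theorem length_eval_le [DecidableEq R] (N : ℕ) (c : Cmd σ R Γ) (s : σ × (R → List Γ)) (r : R) :
    ((c.eval N s).2 r).length ≤ (s.2 r).length + c.growth.eval N := by
  induction c generalizing s with
  | push q f =>
    simp only [eval, growth, Polynomial.eval_one]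
    by_cases h : r = q
    · subst h; simp
    · simp [h]
  | pop q f =>
    simp only [eval, growth, Polynomial.eval_zero]
    by_cases h : r = q
    · subst h; simp
    · simp [h]
  | load f => simp [eval]
  | ite p c d ihc ihd =>
    simp only [eval, growth, Polynomial.eval_add]
    cases p s.1
    · exact (ihd s).trans (by omega)
    · exact (ihc s).trans (by omega)
  | seq c d ihc ihd =>
    simp only [eval, growth, Polynomial.eval_add]
    exact (ihd _).trans (by have := ihc s; omega)
  | loop c ih =>
    simp only [eval, growth, Polynomial.eval_mul, Polynomial.eval_X]
    have : ∀ n, ((((c.eval N)^[n]) s).2 r).length ≤ (s.2 r).length + n * c.growth.eval N := by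
      intro n
      induction n with
      | zero => simp
      | succ n ihn =>
        rw [Function.iterate_succ_apply']
        refine (ih _).trans ?_
        rw [Nat.succ_mul]; omega
    exact this N

end Cmd

namespace Cmd

variable {σ R Γ : Type}

/-! ### The machine of a program -/

section machine
variable [DecidableEq R] {D : ℕ} {Λ : Type}

/-- Push a symbol on all clocks in a list. -/
def pushClocks (l : List (Fin D)) (K : MStmt σ R Γ D Λ) : MStmt σ R Γ D Λ :=
  l.foldr (fun i q => .push (Stack.clk i) (fun _ => ()) q) K

theorem stepAux_pushClocks (l : List (Fin D)) (K : MStmt σ R Γ D Λ) (v : σ × Bool)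
    (S : R → List Γ) (A B : Fin D → ℕ) :
    Turing.TM2.stepAux (pushClocks l K) v (conf S A B) =
      Turing.TM2.stepAux K v (conf S (fun i => A i + l.count i) B) := by
  induction l generalizing A with
  | nil => simp [pushClocks]
  | cons i l ih =>
    have h : Function.update (conf S A B) (Stack.clk i) (() :: conf S A B (Stack.clk i)) =
        conf S (Function.update A i (A i + 1)) B := by
      rw [← update_conf_clk, List.replicate_succ]; rfl
    rw [pushClocks, List.foldr_cons, Turing.TM2.stepAux, h, ← pushClocks, ih]
    congr 2
    funext j
    by_cases hj : j = i
    · subst hj; simp; omega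
    · simp [hj, Ne.symm hj]

/-- Pop all program stacks in a list, and report in the scratch bit whether one was nonempty. -/
def popRegs (l : List R) (K : MStmt σ R Γ D Λ) : MStmt σ R Γ D Λ :=
  l.foldr (fun r q => .pop (Stack.reg r) (fun v o => (v.1, v.2 || o.isSome)) q) K

/-- Pop all clocks in a list, and report in the scratch bit whether one was nonempty. -/
def popClocks (l : List (Fin D)) (K : MStmt σ R Γ D Λ) : MStmt σ R Γ D Λ :=
  l.foldr (fun i q => .pop (Stack.clk i) (fun v o => (v.1, v.2 || o.isSome)) q) K

theorem stepAux_popRegs (l : List R) (hl : l.Nodup) (K : MStmt σ R Γ D Λ) (v : σ) (b : Bool)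
    (S : R → List Γ) (A B : Fin D → ℕ) :
    Turing.TM2.stepAux (popRegs l K) (v, b) (conf S A B) =
      Turing.TM2.stepAux K (v, b || l.any fun r => (S r).head?.isSome)
        (conf (fun r => if r ∈ l then (S r).tail else S r) A B) := by
  induction l generalizing S b with
  | nil => simp [popRegs]
  | cons r l ih =>
    rw [List.nodup_cons] at hl
    have h : Function.update (conf S A B) (Stack.reg r) (conf S A B (Stack.reg r)).tail =
        conf (Function.update S r (S r).tail) A B := by
      rw [← update_conf_reg]; rfl
    rw [popRegs, List.foldr_cons, Turing.TM2.stepAux, h, ← popRegs, ih hl.2]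
    have hany : (l.any fun q => (Function.update S r (S r).tail q).head?.isSome) =
        l.any fun q => (S q).head?.isSome := by
      rw [Bool.eq_iff_iff, List.any_eq_true, List.any_eq_true]
      refine exists_congr fun q => and_congr_right fun hq => ?_
      rw [Function.update_of_ne (ne_of_mem_of_not_mem hq hl.1)]
    have hS : (fun q => if q ∈ l then (Function.update S r (S r).tail q).tail
          else Function.update S r (S r).tail q) =
        fun q => if q ∈ r :: l then (S q).tail else S q := by
      funext q
      by_cases hq : q = r
      · subst hq; simp [hl.1]
      · simp [hq]
    rw [hany, hS, List.any_cons, Bool.or_assoc]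
    rfl

theorem stepAux_popClocks (l : List (Fin D)) (hl : l.Nodup) (K : MStmt σ R Γ D Λ) (v : σ)
    (b : Bool) (S : R → List Γ) (A B : Fin D → ℕ) :
    Turing.TM2.stepAux (popClocks l K) (v, b) (conf S A B) =
      Turing.TM2.stepAux K (v, b || l.any fun i => decide (A i ≠ 0))
        (conf S (fun i => if i ∈ l then A i - 1 else A i) B) := by
  induction l generalizing A b with
  | nil => simp [popClocks]
  | cons r l ih =>
    rw [List.nodup_cons] at hl
    have h : Function.update (conf S A B) (Stack.clk r) (conf S A B (Stack.clk r)).tail =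
        conf S (Function.update A r (A r - 1)) B := by
      rw [← update_conf_clk, ← List.tail_replicate]; rfl
    have h' : (conf S A B (Stack.clk r)).head?.isSome = decide (A r ≠ 0) := by
      cases hA : A r <;> simp [conf, hA]
    rw [popClocks, List.foldr_cons, Turing.TM2.stepAux, h, ← popClocks, ih hl.2, h']
    have hany : (l.any fun q => decide (Function.update A r (A r - 1) q ≠ 0)) =
        l.any fun q => decide (A q ≠ 0) := by
      rw [Bool.eq_iff_iff, List.any_eq_true, List.any_eq_true]
      refine exists_congr fun q => and_congr_right fun hq => ?_
      rw [Function.update_of_ne (ne_of_mem_of_not_mem hq hl.1)]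
    have hS : (fun q => if q ∈ l then Function.update A r (A r - 1) q - 1
          else Function.update A r (A r - 1) q) =
        fun q => if q ∈ r :: l then A q - 1 else A q := by
      funext q
      by_cases hq : q = r
      · subst hq; simp [hl.1]
      · simp [hq]
    rw [hany, hS, List.any_cons, Bool.or_assoc]

end machine

/-- What the machine of a program has to know about the control state: an initial state, an
answer to be read off at the end, and a place for the symbol read last. -/
structure Interface (σ Γ : Type) where
  init : σ
  answer : σ → Bool
  put : σ → Option Γ → σ
  get : σ → Γ
  get_put : ∀ v a, get (put v (some a)) = a
  put_init : put init none = init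
  put_put : ∀ v a b, put (put v a) b = put v b

/-- The program of the machine. The label `inl false` moves the input (reversed) to the stack `x`
and winds up the clocks; the label `inl true` empties all stacks and writes the answer. -/
noncomputable def machineCode [Fintype R] (I : Interface σ Γ) (c : Cmd σ R Γ) (z x : R) :
    Bool ⊕ c.Label → MStmt σ R Γ c.depth (Bool ⊕ c.Label)
  | Sum.inl false =>
    .pop (Stack.reg z) (fun v o => (I.put v.1 o, o.isSome))
      (.branch (fun v => v.2)
        (.push (Stack.reg x) (fun v => I.get v.1)
          (pushClocks (List.finRange c.depth) (.goto fun _ => Sum.inl false)))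
        (c.entry le_rfl Sum.inr (.goto fun _ => Sum.inl true)))
  | Sum.inl true =>
    .load (fun v => (v.1, false))
      (popRegs Finset.univ.toList (popClocks (List.finRange c.depth)
        (.branch (fun v => v.2)
          (.goto fun _ => Sum.inl true)
          (.push Stack.out (fun v => I.answer v.1) (.load (fun _ => (I.init, false)) .halt)))))
  | Sum.inr l => c.code le_rfl Sum.inr (.goto fun _ => Sum.inl true) l

section correctness
variable [DecidableEq R] [Fintype R] (I : Interface σ Γ) (c : Cmd σ R Γ) (z x : R)

/-- The first phase of the machine: each symbol of the input winds up all clocks by one. -/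
theorem runsIn_load (hzx : x ≠ z) (w : List Γ) (a : Option Γ) (b : Bool) (S : R → List Γ) (n : ℕ)
    (hS : S z = w) :
    RunsIn (machineCode I c z x) (w.length + 1)
      ⟨some (Sum.inl false), (I.put I.init a, b), conf S (fun _ => n) (fun _ => 0)⟩
      (Turing.TM2.stepAux (c.entry le_rfl Sum.inr (.goto fun _ => Sum.inl true)) (I.init, false)
        (conf (Function.update (Function.update S z []) x (w.reverse ++ S x))
          (fun _ => n + w.length) (fun _ => 0))) := by
  induction w generalizing a b S n with
  | nil =>
    have := RunsIn.step (M := machineCode I c z x) (Sum.inl false) (I.put I.init a, b)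
      (conf S (fun _ => n) (fun _ => 0))
    simp only [machineCode, Turing.TM2.stepAux, update_conf_reg] at this
    simpa [conf, hS, I.put_put, I.put_init, Function.update_comm hzx.symm] using this
  | cons d w ih =>
    have h1 := RunsIn.step (M := machineCode I c z x) (Sum.inl false) (I.put I.init a, b)
      (conf S (fun _ => n) (fun _ => 0))
    have h2 := ih (some d) true (Function.update (Function.update S z w) x (d :: S x)) (n + 1)
      (by rw [Function.update_of_ne hzx.symm, Function.update_self])
    simp only [machineCode, Turing.TM2.stepAux, update_conf_reg] at h1
    have e1 : conf S (fun _ => n) (fun _ : Fin c.depth => 0) (Stack.reg z) = d :: w := hS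
    have e2 : conf (Function.update S z w) (fun _ => n) (fun _ : Fin c.depth => 0)
        (Stack.reg x) = S x := by
      simp [conf, hzx]
    have e3 : ∀ i : Fin c.depth, (List.finRange c.depth).count i = 1 := fun i =>
      List.count_eq_one_of_mem (List.nodup_finRange _) (List.mem_finRange _)
    simp only [e1, e2, List.head?_cons, List.tail_cons, I.put_put, I.get_put, Option.isSome_some,
      cond_true, stepAux_pushClocks, e3, Turing.TM2.stepAux] at h1
    have h3 := (h1.trans h2).mono (show 1 + (w.length + 1) ≤ (d :: w).length + 1 by simp; omega)
    have e4 : Function.update (Function.update (Function.update (Function.update S z w) x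
        (d :: S x)) z []) x (w.reverse ++ Function.update (Function.update S z w) x (d :: S x) x) =
        Function.update (Function.update S z []) x ((d :: w).reverse ++ S x) := by
      funext r
      by_cases hx : r = x
      · subst hx; simp
      · by_cases hz : r = z
        · subst hz; simp [hx]
        · simp [hx, hz]
    rw [e4] at h3
    rwa [show n + 1 + w.length = n + (d :: w).length by simp; omega] at h3

/-- The last phase of the machine: at a halt, all stacks but the output have to be empty. -/
theorem runsIn_clean (v : σ) (b : Bool) (m : ℕ) (S : R → List Γ) (A : Fin c.depth → ℕ)
    (hS : ∀ r, (S r).length ≤ m) (hA : ∀ i, A i ≤ m) :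
    RunsIn (machineCode I c z x) (m + 1)
      ⟨some (Sum.inl true), (v, b), conf S A (fun _ => 0)⟩
      ⟨none, (I.init, false),
        Function.update (conf (fun _ => []) (fun _ => 0) (fun _ => 0)) Stack.out
          [I.answer v]⟩ := by
  induction m generalizing S A b with
  | zero =>
    have h1 := RunsIn.step (M := machineCode I c z x) (Sum.inl true) (v, b)
      (conf S A (fun _ => 0))
    have eS : S = fun _ => [] := funext fun r => List.length_eq_zero_iff.1 (Nat.le_zero.1 (hS r))
    have eA : A = fun _ => 0 := funext fun i => Nat.le_zero.1 (hA i)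
    subst eS eA
    simp only [machineCode, Turing.TM2.stepAux] at h1
    rw [stepAux_popRegs _ (Finset.nodup_toList _),
      stepAux_popClocks _ (List.nodup_finRange _)] at h1
    have hn : ∀ {α : Type} (l : List α), (l.any fun _ => false) = false := fun l => by
      rw [List.any_eq_false]; simp
    simpa [conf, hn] using h1
  | succ m ih =>
    have h1 := RunsIn.step (M := machineCode I c z x) (Sum.inl true) (v, b)
      (conf S A (fun _ => 0))
    simp only [machineCode, Turing.TM2.stepAux] at h1
    rw [stepAux_popRegs _ (Finset.nodup_toList _),
      stepAux_popClocks _ (List.nodup_finRange _)] at h1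
    simp only [Finset.mem_toList, Finset.mem_univ, if_true, List.mem_finRange,
      Turing.TM2.stepAux, Bool.false_or] at h1
    generalize hf : ((Finset.univ.toList.any fun r => (S r).head?.isSome) ||
      (List.finRange c.depth).any fun i => decide (A i ≠ 0)) = f at h1
    cases f with
    | true =>
      have h2 := ih true (fun r => (S r).tail) (fun i => A i - 1)
        (fun r => by rw [List.length_tail]; have := hS r; omega) (fun i => by
          have := hA i; omega)
      exact (h1.trans h2).mono (by omega)
    | false =>
      rw [Bool.or_eq_false_iff, List.any_eq_false, List.any_eq_false] at hf
      have eS : S = fun _ => [] := funext fun r => by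
        have := hf.1 r (by simp)
        cases h : S r with
        | nil => rfl
        | cons a l => simp [h] at this
      have eA : A = fun _ => 0 := funext fun i => by
        have := hf.2 i (by simp)
        simpa using this
      subst eS eA
      refine RunsIn.mono ?_ (show 1 ≤ m + 1 + 1 by omega)
      simpa [conf] using h1

theorem runsIn_machine (hzx : x ≠ z) (w : List Γ) :
    RunsIn (machineCode I c z x)
      ((Polynomial.X + 1 + c.cost + (Polynomial.X + c.growth + 1)).eval w.length)
      ⟨some (Sum.inl false), (I.init, false),
        conf (Function.update (fun _ => []) z w) (fun _ => 0) (fun _ => 0)⟩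
      ⟨none, (I.init, false),
        Function.update (conf (fun _ => []) (fun _ => 0) (fun _ => 0)) Stack.out
          [I.answer (c.eval w.length
            (I.init, Function.update (fun _ => []) x w.reverse)).1]⟩ := by
  have h1 := runsIn_load I c z x hzx w none false (Function.update (fun _ => []) z w) 0 (by simp)
  rw [Function.update_idem, Function.update_of_ne hzx, List.append_nil, I.put_init,
    show Function.update (fun _ => ([] : List Γ)) z [] = fun _ => [] from
      Function.update_eq_self z _, zero_add] at h1
  obtain ⟨b, h2⟩ := runsIn_entry (machineCode I c z x) w.length c le_rfl Sum.inr
    (.goto fun _ => Sum.inl true) (fun _ => rfl) I.init false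
    (Function.update (fun _ => []) x w.reverse) (fun _ => w.length) (fun _ => 0)
    (fun _ _ => ⟨rfl, rfl⟩)
  have h3 := runsIn_clean I c z x
    (c.eval w.length (I.init, Function.update (fun _ => []) x w.reverse)).1 b
    (w.length + c.growth.eval w.length) _ (fun _ => w.length)
    (fun r => (length_eval_le w.length c (I.init, Function.update (fun _ => []) x w.reverse)
      r).trans (by
        by_cases hr : r = x
        · subst hr; simp
        · simp [hr])) (fun _ => Nat.le_add_right _ _)
  refine ((h1.trans h2).trans h3).mono (le_of_eq ?_)
  simp

end correctness

/-- The machine of a program, as a machine with finitely many states, labels and symbols. -/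
noncomputable def machine [DecidableEq R] [Fintype R] [Fintype σ] [Fintype Γ] (I : Interface σ Γ)
    (c : Cmd σ R Γ) (z x : R) : Turing.FinTM2 :=
  letI := c.fintypeLabel
  { K := Stack R c.depth
    k₀ := Stack.reg z
    k₁ := Stack.out
    Γ := Symb R Γ c.depth
    Λ := Bool ⊕ c.Label
    main := Sum.inl false
    σ := σ × Bool
    initialState := (I.init, false)
    Γk₀Fin := inferInstanceAs (Fintype Γ)
    m := machineCode I c z x }

theorem initList_machine [DecidableEq R] [Fintype R] [Fintype σ] [Fintype Γ] (I : Interface σ Γ)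
    (c : Cmd σ R Γ) (z x : R) (w : List Γ) :
    Turing.initList (machine I c z x) w = ⟨some (Sum.inl false), (I.init, false),
      conf (Function.update (fun _ => []) z w) (fun _ => 0) (fun _ => 0)⟩ := by
  unfold Turing.initList
  refine congrArg (Turing.TM2.Cfg.mk _ _) (funext fun k => ?_)
  rcases k with _ | r | i | i
  · rfl
  · by_cases hr : r = z
    · subst hr
      refine (dif_pos rfl).trans ?_
      rw [conf, Function.update_self]
      rfl
    · refine (dif_neg (fun h => hr (Stack.reg.inj h))).trans ?_
      rw [conf, Function.update_of_ne hr]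
      rfl
  · rfl
  · rfl

theorem haltList_machine [DecidableEq R] [Fintype R] [Fintype σ] [Fintype Γ] (I : Interface σ Γ)
    (c : Cmd σ R Γ) (z x : R) (w : List Bool) :
    Turing.haltList (machine I c z x) w = ⟨none, (I.init, false),
      Function.update (conf (fun _ => []) (fun _ => 0) (fun _ => 0)) Stack.out w⟩ := by
  unfold Turing.haltList
  refine congrArg (Turing.TM2.Cfg.mk _ _) (funext fun k => ?_)
  rcases k with _ | r | i | i <;> rfl

/-- Every program decides a relation on words in polynomial time. The input is handed over to the
program in reversed order. -/
theorem polyTimeDecides [DecidableEq R] [Fintype R] [Fintype σ] {Γ : Type} [Fintype Γ]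
    (I : Interface σ (Option Γ)) (c : Cmd σ R (Option Γ)) (z x : R) (hzx : x ≠ z) :
    PolyTimeDecides fun uw : List Γ × List Γ =>
      I.answer (c.eval (pairCode uw).length
        (I.init, Function.update (fun _ => []) x (pairCode uw).reverse)).1 := by
  refine ⟨{
    tm := machine I c z x
    inputAlphabet := Equiv.refl (Option Γ)
    outputAlphabet := Equiv.refl Bool
    time := Polynomial.X + 1 + c.cost + (Polynomial.X + c.growth + 1)
    outputsFun := fun uw => ?_ }⟩
  have h := (runsIn_machine I c z x hzx (pairCode uw)).some
  have e : List.map (Equiv.refl (Option Γ)).invFun (pairCode uw) = pairCode uw := List.map_id _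
  have key : ∀ (w : List (Option Γ)) (b : Bool) (t : ℕ), StateTransition.EvalsToInTime
      (Turing.TM2.step (machineCode I c z x))
      ⟨some (Sum.inl false), (I.init, false),
        conf (Function.update (fun _ => []) z w) (fun _ => 0) (fun _ => 0)⟩
      (some ⟨none, (I.init, false),
        Function.update (conf (fun _ => []) (fun _ => 0) (fun _ => 0)) Stack.out [b]⟩) t →
      Turing.TM2OutputsInTime (machine I c z x) w (some [b]) t := by
    intro w b t hw
    exact Eq.mpr (congrArg₂ (fun a a' => StateTransition.EvalsToInTime
      (Turing.TM2.step (machineCode I c z x)) a (some a') t) (initList_machine I c z x w)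
      (haltList_machine I c z x [b])) hw
  exact Eq.mpr (congrArg (fun l : List (Option Γ) =>
    Turing.TM2OutputsInTime (machine I c z x) l (some [_]) _) e) (key _ _ _ h)

end Cmd

/-! ### Loops over the contents of a stack -/

namespace Cmd

variable {σ R Γ : Type}

/-- The program does not touch the stack `r`. -/
def Avoids (r : R) : Cmd σ R Γ → Prop
  | push q _ => q ≠ r
  | pop q _ => q ≠ r
  | load _ => True
  | ite _ c d => c.Avoids r ∧ d.Avoids r
  | seq c d => c.Avoids r ∧ d.Avoids r
  | loop c => c.Avoids r

/-- A program that avoids a stack runs in the same way whatever this stack contains. -/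
theorem Avoids.eval_update [DecidableEq R] {r : R} {c : Cmd σ R Γ} (h : c.Avoids r) (N : ℕ)
    (v : σ) (S : R → List Γ) (l : List Γ) :
    c.eval N (v, Function.update S r l) =
      ((c.eval N (v, S)).1, Function.update (c.eval N (v, S)).2 r l) := by
  induction c generalizing v S with
  | push q f =>
    have h : q ≠ r := h
    simp [eval, h, Function.update_comm h]
  | pop q f =>
    have h : q ≠ r := h
    simp [eval, h, Function.update_comm h]
  | load f => rfl
  | ite p c d ihc ihd =>
    simp only [eval]
    cases p v
    · exact ihd h.2 v S
    · exact ihc h.1 v S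
  | seq c d ihc ihd =>
    simp only [eval]
    rw [ihc h.1, ihd h.2]
  | loop c ih =>
    simp only [eval]
    generalize N = n at *
    have : ∀ m v S, (c.eval n)^[m] (v, Function.update S r l) =
        (((c.eval n)^[m] (v, S)).1, Function.update ((c.eval n)^[m] (v, S)).2 r l) := by
      intro m
      induction m with
      | zero => intro v S; rfl
      | succ m ihm =>
        intro v S
        rw [Function.iterate_succ_apply, ih h, ihm, Function.iterate_succ_apply]
    exact this n v S

theorem Avoids.eval_apply [DecidableEq R] {r : R} {c : Cmd σ R Γ} (h : c.Avoids r) (N : ℕ)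
    (v : σ) (S : R → List Γ) : (c.eval N (v, S)).2 r = S r := by
  have := h.eval_update N v S (S r)
  rw [Function.update_eq_self] at this
  rw [this]
  simp

end Cmd

/-- Modes of the finite control. -/
inductive Mode : Type where
  | outer | gates | head | arg | lookup | preds | pred | index | out | done | fail
  deriving DecidableEq

instance : Fintype Mode where
  elems := {.outer, .gates, .head, .arg, .lookup, .preds, .pred, .index, .out, .done, .fail}
  complete q := by cases q <;> decide

/-- The control state: the symbol read last, the mode, the answer, and a bit for the circuit that
is being read. -/
structure Control : Type where
  cur : Option (Option Letter)
  mode : Mode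
  ok : Bool
  bit : Bool
  deriving Fintype

/-- The stacks of the verifier. -/
inductive Reg : Type where
  | X | W | U | V | P | Q | T | A | B | Y | K | C
  deriving DecidableEq

instance : Fintype Reg where
  elems := {.X, .W, .U, .V, .P, .Q, .T, .A, .B, .Y, .K, .C}
  complete r := by cases r <;> decide

/-- Contents of a stack. -/
abbrev Tape : Type := List (Option Letter)

/-- Contents of all stacks of the verifier. -/
structure Mem : Type where
  X : Tape := []
  W : Tape := []
  U : Tape := []
  V : Tape := []
  P : Tape := []
  Q : Tape := []
  T : Tape := []
  A : Tape := []
  B : Tape := []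
  Y : Tape := []
  K : Tape := []
  C : Tape := []

namespace Mem

/-- The contents of a stack. -/
def get (m : Mem) : Reg → Tape
  | .X => m.X
  | .W => m.W
  | .U => m.U
  | .V => m.V
  | .P => m.P
  | .Q => m.Q
  | .T => m.T
  | .A => m.A
  | .B => m.B
  | .Y => m.Y
  | .K => m.K
  | .C => m.C

variable (m : Mem) (l : Tape)

@[simp] theorem update_X : Function.update m.get .X l = {m with X := l}.get := by
  funext r; cases r <;> rfl
@[simp] theorem update_W : Function.update m.get .W l = {m with W := l}.get := by
  funext r; cases r <;> rfl
@[simp] theorem update_U : Function.update m.get .U l = {m with U := l}.get := by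
  funext r; cases r <;> rfl
@[simp] theorem update_V : Function.update m.get .V l = {m with V := l}.get := by
  funext r; cases r <;> rfl
@[simp] theorem update_P : Function.update m.get .P l = {m with P := l}.get := by
  funext r; cases r <;> rfl
@[simp] theorem update_Q : Function.update m.get .Q l = {m with Q := l}.get := by
  funext r; cases r <;> rfl
@[simp] theorem update_T : Function.update m.get .T l = {m with T := l}.get := by
  funext r; cases r <;> rfl
@[simp] theorem update_A : Function.update m.get .A l = {m with A := l}.get := by
  funext r; cases r <;> rfl
@[simp] theorem update_B : Function.update m.get .B l = {m with B := l}.get := by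
  funext r; cases r <;> rfl
@[simp] theorem update_Y : Function.update m.get .Y l = {m with Y := l}.get := by
  funext r; cases r <;> rfl
@[simp] theorem update_K : Function.update m.get .K l = {m with K := l}.get := by
  funext r; cases r <;> rfl
@[simp] theorem update_C : Function.update m.get .C l = {m with C := l}.get := by
  funext r; cases r <;> rfl

-- These are proved by rewriting, so that `simp` does not take them for definitional equalities.
@[simp] theorem get_X : m.get .X = m.X := by rw [get]
@[simp] theorem get_W : m.get .W = m.W := by rw [get]
@[simp] theorem get_U : m.get .U = m.U := by rw [get]
@[simp] theorem get_V : m.get .V = m.V := by rw [get]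
@[simp] theorem get_P : m.get .P = m.P := by rw [get]
@[simp] theorem get_Q : m.get .Q = m.Q := by rw [get]
@[simp] theorem get_T : m.get .T = m.T := by rw [get]
@[simp] theorem get_A : m.get .A = m.A := by rw [get]
@[simp] theorem get_B : m.get .B = m.B := by rw [get]
@[simp] theorem get_Y : m.get .Y = m.Y := by rw [get]
@[simp] theorem get_K : m.get .K = m.K := by rw [get]
@[simp] theorem get_C : m.get .C = m.C := by rw [get]

end Mem

namespace Verifier

/-- Programs of the verifier. -/
abbrev Prog : Type := Cmd Control Reg (Option Letter)

/-- States of the verifier. -/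
abbrev State : Type := Control × (Reg → Tape)

/-- Do nothing. -/
def skip : Prog := .load id

/-- Pop a symbol from a stack. -/
def read (r : Reg) : Prog := .pop r fun v o => {v with cur := o}

/-- Push the symbol read last. -/
def write (r : Reg) : Prog := .push r fun v => v.cur.getD none

/-- Push a letter. -/
def put (r : Reg) (a : Letter) : Prog := .push r fun _ => some a

/-- Pop a symbol and forget it. -/
def drop (r : Reg) : Prog := .pop r fun v _ => v

/-- Forget the symbol read last. -/
def forget : Prog := .load fun v => {v with cur := none}

/-- Change the mode. -/
def goMode (q : Mode) : Prog := .load fun v => {v with mode := q}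

/-- Branch on the mode. -/
def ifMode (q : Mode) (c d : Prog) : Prog := .ite (fun v => decide (v.mode = q)) c d

/-- Branch on the symbol read last. -/
def ifCur (a : Letter) (c d : Prog) : Prog := .ite (fun v => decide (v.cur = some (some a))) c d

/-- Branch on the mode and the symbol read last. -/
def ifOn (q : Mode) (a : Letter) (c d : Prog) : Prog :=
  .ite (fun v => decide (v.mode = q ∧ v.cur = some (some a))) c d

/-- Run a program for every symbol of a stack, which is emptied. -/
def forEach (r : Reg) (c : Prog) : Prog :=
  .seq forget (.loop (.seq (read r) (.seq (.ite (fun v => v.cur.isSome) c skip) forget)))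

/-- The effect of the body of a loop on one symbol. -/
def step (N : ℕ) (c : Prog) (s : State) (a : Option Letter) : State :=
  forget.eval N (c.eval N ({s.1 with cur := some a}, s.2))

/-- A loop over a stack has as many rounds as the input has letters; the rounds that find the stack
empty change nothing. -/
theorem eval_forEach {r : Reg} {c : Prog} (h : c.Avoids r) {N : ℕ} (v : Control) (S : Reg → Tape)
    (hN : (S r).length ≤ N) :
    (forEach r c).eval N (v, S) =
      (S r).foldl (step N c) ({v with cur := none}, Function.update S r []) := by
  have key : ∀ (l : Tape) (n : ℕ) (v : Control) (S : Reg → Tape), l.length ≤ n → v.cur = none →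
      (Cmd.eval N (.seq (read r) (.seq (.ite (fun v => v.cur.isSome) c skip) forget)))^[n]
        (v, Function.update S r l) = l.foldl (step N c) (v, Function.update S r []) := by
    intro l
    induction l with
    | nil =>
      intro n v S _ hv
      refine Function.iterate_fixed ?_ n
      obtain ⟨cur, mode, ok, bit⟩ := v
      simp only at hv
      subst hv
      simp [Cmd.eval, read, forget, skip]
    | cons a l ih =>
      intro n v S hn hv
      obtain ⟨n, rfl⟩ : ∃ k, n = k + 1 := ⟨n - 1, by simp at hn; omega⟩
      rw [Function.iterate_succ_apply, List.foldl_cons]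
      have e : Cmd.eval N (.seq (read r) (.seq (.ite (fun v => v.cur.isSome) c skip) forget))
          (v, Function.update S r (a :: l)) =
          ((step N c (v, Function.update S r []) a).1,
            Function.update (step N c (v, Function.update S r []) a).2 r l) := by
        simp [Cmd.eval, read, forget, step, h.eval_update]
      rw [e, ih n _ _ (by simpa using hn) (by simp [step, forget, Cmd.eval])]
      congr 1
      refine Prod.ext rfl ?_
      have : (step N c (v, Function.update S r []) a).2 r = [] := by
        simp only [step, forget, Cmd.eval]
        rw [h.eval_apply, Function.update_self]
      simp only
      conv_rhs => rw [← Function.update_eq_self r (step N c (v, Function.update S r []) a).2, this]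
  have := key (S r) N {v with cur := none} S hN rfl
  rw [Function.update_eq_self] at this
  rw [← this]
  rfl

/-- Pour a stack over another one. -/
def pour (r t : Reg) : Prog := forEach r (write t)

/-- Empty a stack. -/
def clear (r : Reg) : Prog := forEach r skip

/-- Copy a stack on top of another one, with the help of the stack `T`. -/
def copy (r t : Reg) : Prog :=
  .seq (pour r .T) (forEach .T (.seq (write r) (write t)))

theorem eval_pour {r t : Reg} (h : t ≠ r) {N : ℕ} (v : Control) (S : Reg → Tape)
    (hN : (S r).length ≤ N) :
    (pour r t).eval N (v, S) = ({v with cur := none},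
      Function.update (Function.update S r []) t ((S r).reverse ++ S t)) := by
  rw [pour, eval_forEach (by exact h) _ _ hN]
  generalize S r = l
  have : ∀ (l l' : Tape), l.foldl (step N (write t)) ({v with cur := none},
      Function.update (Function.update S r []) t l') = ({v with cur := none},
      Function.update (Function.update S r []) t (l.reverse ++ l')) := by
    intro l
    induction l with
    | nil => intro l'; rfl
    | cons a l ih =>
      intro l'
      simp only [List.foldl_cons, List.reverse_cons, List.append_assoc, List.singleton_append,
        ← ih (a :: l')]
      simp [step, write, forget, Cmd.eval]
  have h' := this l (S t)
  rw [← h', ← Function.update_of_ne h [] S, Function.update_eq_self]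

theorem eval_clear {r : Reg} {N : ℕ} (v : Control) (S : Reg → Tape) (hN : (S r).length ≤ N) :
    (clear r).eval N (v, S) = ({v with cur := none}, Function.update S r []) := by
  rw [clear, eval_forEach (by exact trivial) _ _ hN]
  generalize S r = l
  induction l with
  | nil => rfl
  | cons a l ih => simpa [step, forget, skip, Cmd.eval] using ih

theorem eval_copy {r t : Reg} (hr : r ≠ .T) (ht : t ≠ .T) (hrt : t ≠ r) {N : ℕ} (v : Control)
    (S : Reg → Tape) (hN : (S r).length ≤ N) (hT : S .T = []) :
    (copy r t).eval N (v, S) =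
      ({v with cur := none}, Function.update S t (S r ++ S t)) := by
  rw [copy, Cmd.eval, eval_pour hr.symm _ _ hN, hT, List.append_nil,
    eval_forEach (by exact ⟨hr, ht⟩) _ _ (by simpa using hN), Function.update_self,
    Function.update_idem]
  have : ∀ (l l₁ l₂ : Tape), l.foldl (step N (.seq (write r) (write t))) ({v with cur := none},
      Function.update (Function.update S r l₁) t l₂) = ({v with cur := none},
      Function.update (Function.update S r (l.reverse ++ l₁)) t (l.reverse ++ l₂)) := by
    intro l
    induction l with
    | nil => intro _ _; rfl
    | cons a l ih =>
      intro l₁ l₂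
      simp only [List.foldl_cons, List.reverse_cons, List.append_assoc, List.singleton_append,
        ← ih (a :: l₁)]
      simp [step, write, forget, Cmd.eval, hrt.symm, Function.update_comm hrt]
  have h := this (S r).reverse [] (S t)
  rw [List.reverse_reverse, List.append_nil, Function.update_eq_self] at h
  rw [← h]
  congr 2
  funext q
  by_cases h1 : q = t
  · subst h1; simp [ht, hrt]
  · by_cases h2 : q = r
    · subst h2; simp [hr, h1]
    · by_cases h3 : q = Reg.T
      · subst h3; simp [h1, h2, hT]
      · simp [h1, h2, h3]

/-! ### The program of the verifier -/

/-- Run a program unless the certificate has been rejected. -/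
def ifOk (c : Prog) : Prog := .ite (fun v => v.ok) c skip

/-- One letter of the input, which stands in reversed order on the stack `X`: the letters before
the separator belong to the certificate, those after it to the instance. -/
def splitBody : Prog :=
  ifMode .outer (.ite (fun v => decide (v.cur = some none)) (goMode .done) (write .W)) (write .U)

/-- Separate the two words of the input. -/
def splitInput : Prog := forEach .X splitBody

/-- One letter of the wiring on the stack `W`, which has to be a strictly increasing list of
automata. The membership bits of this list are collected (in reversed order) on `B`. While an
automaton is being read, each tick of its name first removes one symbol from a copy of `B` on the
stack `P`, and then, when this copy is used up, appends a bit to `B`. Thus the name is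
rejected if it ends too early, that is, if it does not exceed the automata before it. -/
def wiringBody : Prog :=
  ifMode .done (write .Y) <|
  ifOn .outer .cons (goMode .arg) <|
  ifOn .outer .nil (goMode .done) <|
  ifOn .arg .auto (.seq (copy .B .P) (goMode .lookup)) <|
  ifOn .lookup .tick
    (.seq (read .P) (.ite (fun v => v.cur.isNone) (put .B (.bit false)) skip)) <|
  ifOn .lookup .nil
    (.seq (read .P) (.ite (fun v => v.cur.isNone)
      (.seq (put .B (.bit true)) (goMode .outer)) (goMode .fail))) <|
  goMode .fail

/-- Read the wiring of the certificate. If it is accepted, its membership bits are left on `V`, and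
the rest of the certificate on `W`. -/
def readWiring : Prog :=
  .seq (goMode .outer) <| .seq (forEach .W wiringBody) <|
  .seq (.load fun v => {v with ok := decide (v.mode = .done)}) <|
  ifOk (.seq (pour .Y .W) (pour .B .V))

/-- One letter of the instance: each tick of the number of automata removes one of the membership
bits, of which there must not be more than automata. -/
def sizeBody : Prog :=
  ifMode .done (write .B) <| ifCur .nil (goMode .done) (drop .Q)

/-- Read the number of automata, and remove it from the word of the instance. -/
def readSize : Prog :=
  .seq (copy .V .Q) <| .seq (goMode .outer) <| .seq (forEach .U sizeBody) <| .seq (pour .B .U) <|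
  .seq (read .Q) <| .load fun v => {v with ok := v.cur.isNone, cur := none}

/-- One letter of the instance. Letters other than names of variables are copied to `Y`; the name
of a variable in the list is replaced by that of its input. While a variable is being read, the
stack `P` holds the membership bits that have not been passed, and the stacks `Q` and `C` count all
bits and the set bits that have been passed: these are the unary names of the variable and of its
input. The bits of the bound are moved to the stack `K`. -/
def substBody : Prog :=
  ifOn .lookup .tick
    (.seq (write .Q) (.seq (read .P) (ifCur (.bit true) (put .C .tick) skip))) <|
  ifMode .lookup
    (.seq (read .P) <|
      .seq (ifCur (.bit true) (.seq (put .Y .inp) (.seq (pour .C .Y) (clear .Q)))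
        (.seq (put .Y .auto) (.seq (pour .Q .Y) (clear .C)))) <|
      .seq (put .Y .nil) <| .seq (clear .P) <| goMode .outer) <|
  ifCur .auto (.seq (copy .V .P) (goMode .lookup)) <|
  ifCur (.bit true) (write .K) <| ifCur (.bit false) (write .K) <| write .Y

/-- Write on `Y` the circuits of the instance with the automata of the list replaced by inputs. -/
def substitute : Prog :=
  .seq (copy .U .X) <| .seq (goMode .outer) <| forEach .X substBody

/-- Compare one letter of the certificate. -/
def compareBody : Prog := .pop .W fun v o => {v with ok := v.ok && decide (o = v.cur)}

/-- Compare the circuits of the certificate with the circuits computed by `substitute`. -/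
def compare : Prog :=
  .seq (pour .Y .X) <| .seq (forEach .X compareBody) <|
  .pop .W fun v o => {v with ok := v.ok && o.isNone}

/-- The automaton that recognizes the boundaries of the circuits in the word of an instance. -/
def nextMode : Mode → Option (Option Letter) → Mode
  | .outer, some (some .cons) => .gates
  | .outer, some (some .nil) => .done
  | .gates, some (some .cons) => .head
  | .gates, some (some .nil) => .out
  | .head, some (some .var) => .arg
  | .head, some (some .conj) => .preds
  | .head, some (some .disj) => .preds
  | .head, some (some .neg) => .index
  | .preds, some (some .cons) => .pred
  | .preds, some (some .nil) => .gates
  | .pred, some (some .nil) => .preds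
  | .index, some (some .nil) => .gates
  | q, _ => q

/-- One letter of the instance in a round of the acyclicity test. The bit of an automaton is set
if it belongs to the list or if the bits of all variables of its circuit were set (on the stack
`A`) before this round. -/
def relaxBody : Prog :=
  ifOn .arg .auto (.seq (copy .A .P) (goMode .lookup)) <|
  ifOn .lookup .tick (drop .P) <|
  ifOn .lookup .nil
    (.seq (read .P) <|
      .seq (.load fun v =>
        {v with bit := v.bit && decide (v.cur = some (some (.bit true))), mode := .gates}) <|
      clear .P) <|
  ifOn .out .nil
    (.seq (read .Q) <|
      .seq (.push .B fun v =>
        some (.bit (decide (v.cur = some (some (.bit true))) || v.bit))) <|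
      .load fun v => {v with bit := true, mode := .outer}) <|
  .load fun v => {v with mode := nextMode v.mode v.cur}

/-- One round of the acyclicity test, from the bits on `A` to the new bits on `A`. -/
def relax : Prog :=
  .seq (copy .U .X) <| .seq (copy .V .Q) <|
  .seq (.load fun v => {v with bit := true, mode := .outer}) <|
  .seq (forEach .X relaxBody) <| .seq (clear .A) <| pour .B .A

/-- The acyclicity test: enough rounds to reach a fixed point. -/
def relaxAll : Prog := .seq (copy .V .A) (.loop relax)

/-- One bit of the decrement, least significant bit first: zeros become ones, up to and including
the lowest one, which becomes zero. -/
def decrementBody : Prog :=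
  ifMode .outer
    (ifCur (.bit true) (.seq (put .T (.bit false)) (goMode .done)) (put .T (.bit true))) (write .T)

/-- Decrement the binary number on the stack `X`, and reject if it is zero. -/
def decrement : Prog :=
  .seq (goMode .outer) <| .seq (forEach .X decrementBody) <| .seq (pour .T .X) <|
  .load fun v => {v with ok := v.ok && decide (v.mode = .done)}

/-- Decrement the bound for a bit that is set. -/
def countBody : Prog := ifCur (.bit true) decrement skip

/-- Check that the list has at most as many members as the bound says. -/
def count : Prog := .seq (pour .K .X) (forEach .V countBody)

/-- Check that one bit is set. -/
def allBody : Prog := .load fun v => {v with ok := v.ok && decide (v.cur = some (some (.bit true)))}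

/-- Check that all bits on the stack `A` are set. -/
def allSet : Prog := forEach .A allBody

/-- The verifier. -/
def verifier : Prog :=
  .seq splitInput <| .seq readWiring <| ifOk <| .seq readSize <| ifOk <|
  .seq substitute <| .seq compare <| .seq relaxAll <| .seq count allSet

/-- The control state of the verifier, as seen by its machine. -/
def interface : Cmd.Interface Control (Option Letter) where
  init := ⟨none, .outer, true, false⟩
  answer v := v.ok
  put v o := {v with cur := o}
  get v := v.cur.getD none
  get_put _ _ := rfl
  put_init := rfl
  put_put _ _ _ := rfl

/-- The relation on words decided by the verifier. -/
def accepts (uw : List Letter × List Letter) : Bool :=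
  (verifier.eval (pairCode uw).length
    (⟨none, .outer, true, false⟩, { X := (pairCode uw).reverse : Mem }.get)).1.ok

theorem polyTimeDecides_accepts : PolyTimeDecides accepts := by
  have h := Cmd.polyTimeDecides interface verifier .W .X (by decide)
  convert h using 2 with uw
  unfold accepts
  congr 4
  funext r
  cases r <;> rfl

/-! ### Membership bits and positions -/

/-- The positions of the bits that are set. -/
def positions (l : List Bool) : List ℕ :=
  (List.range l.length).filter fun j => l.getD j false

theorem positions_append (l : List Bool) (b : Bool) :
    positions (l ++ [b]) = positions l ++ if b then [l.length] else [] := by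
  unfold positions
  rw [List.length_append, List.length_singleton, List.range_succ, List.filter_append]
  congr 1
  · refine List.filter_congr fun j hj => ?_
    rw [List.mem_range] at hj
    simp [List.getD_eq_getElem?_getD, List.getElem?_append_left hj]
  · cases b <;> simp

theorem mem_positions {l : List Bool} {j : ℕ} : j ∈ positions l ↔ l.getD j false = true := by
  unfold positions
  rw [List.mem_filter, List.mem_range]
  refine ⟨fun h => h.2, fun h => ⟨?_, h⟩⟩
  by_contra hj
  rw [List.getD_eq_default _ _ (not_lt.1 hj)] at h
  cases h

theorem lt_of_mem_positions {l : List Bool} {j : ℕ} (h : j ∈ positions l) : j < l.length := by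
  unfold positions at h
  exact List.mem_range.1 (List.mem_of_mem_filter h)

theorem positions_prefix (l l' : List Bool) : positions l <+: positions (l ++ l') := by
  induction l' using List.reverseRecOn with
  | nil => simp
  | append_singleton l' b ih =>
    rw [← List.append_assoc, positions_append]
    exact ih.trans (List.prefix_append _ _)

/-- The input that replaces an automaton is found by counting the bits set below it. -/
theorem idxOf_positions {l : List Bool} {j : ℕ} (h : j ∈ positions l) :
    (positions l).idxOf j = (positions (l.take j)).length := by
  have hj := lt_of_mem_positions h
  have hb : l[j] = true := by
    have := mem_positions.1 h
    rwa [List.getD_eq_getElem _ _ hj] at this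
  obtain ⟨t, ht⟩ := positions_prefix (l.take j ++ [true]) (l.drop (j + 1))
  have hl : l.take j ++ [true] ++ l.drop (j + 1) = l := by
    rw [List.append_assoc, List.singleton_append, ← hb, List.getElem_cons_drop,
      List.take_append_drop]
  have hlen : (l.take j).length = j := by rw [List.length_take]; omega
  have hn : j ∉ positions (l.take j) := fun hh => by
    have := lt_of_mem_positions hh
    omega
  rw [hl, positions_append, if_pos rfl, hlen] at ht
  rw [← ht, List.append_assoc, List.idxOf_append_of_notMem hn]
  simp

/-- The code of the members of a list, without the final letter. -/
def entries (ps : List ℕ) : List Letter :=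
  ps.flatMap fun j => Letter.cons :: Letter.auto :: encodeIdx j

theorem encodeList_eq_entries (ps : List ℕ) :
    encodeList (fun j => Letter.auto :: encodeIdx j) ps = entries ps ++ [Letter.nil] := by
  induction ps with
  | nil => rfl
  | cons j ps ih => simp [encodeList, entries, ih]

theorem encodeIdx_eq (j : ℕ) : encodeIdx j = List.replicate j Letter.tick ++ [Letter.nil] := by
  induction j with
  | zero => rfl
  | succ j ih => simp [encodeIdx, ih, List.replicate_succ]

/-- Bits, as symbols on a stack. -/
def bits (l : List Bool) : Tape := l.map fun b => some (Letter.bit b)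

/-- Letters, as symbols on a stack. -/
def word (l : List Letter) : Tape := l.map some

/-! ### The effect of the parts of the verifier -/

attribute [local simp] Cmd.eval step forget skip read write put drop goMode ifMode ifCur ifOn

theorem eval_pour_get {r t : Reg} (h : t ≠ r) {N : ℕ} (v : Control) (m : Mem)
    (hN : List.length (m.get r) ≤ N) :
    (pour r t).eval N (v, m.get) = ({v with cur := none},
      Function.update (Function.update m.get r []) t ((m.get r).reverse ++ m.get t)) :=
  eval_pour h v _ hN

theorem eval_clear_get {r : Reg} {N : ℕ} (v : Control) (m : Mem)
    (hN : List.length (m.get r) ≤ N) :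
    (clear r).eval N (v, m.get) = ({v with cur := none}, Function.update m.get r []) :=
  eval_clear v _ hN

theorem eval_copy_get {r t : Reg} (hr : r ≠ .T) (ht : t ≠ .T) (hrt : t ≠ r) {N : ℕ} (v : Control)
    (m : Mem) (hN : List.length (m.get r) ≤ N) (hT : m.T = []) :
    (copy r t).eval N (v, m.get) =
      ({v with cur := none}, Function.update m.get t (m.get r ++ m.get t)) :=
  eval_copy hr ht hrt v _ hN hT

theorem eval_splitInput (u w : List Letter) (N : ℕ) (hN : (pairCode (u, w)).length ≤ N)
    (ok b : Bool) :
    splitInput.eval N (⟨none, .outer, ok, b⟩, { X := (pairCode (u, w)).reverse : Mem }.get) =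
      (⟨none, .done, ok, b⟩, { W := word w, U := word u : Mem }.get) := by
  have s1 : ∀ (a : Letter) (m : Mem), step N splitBody (⟨none, .outer, ok, b⟩, m.get) (some a) =
      (⟨none, .outer, ok, b⟩, { m with W := some a :: m.W }.get) := by
    intro a m; simp [splitBody]
  have h1 : ∀ (l : List Letter) (m : Mem), (word l).foldl (step N splitBody)
      (⟨none, .outer, ok, b⟩, m.get) =
      (⟨none, .outer, ok, b⟩, { m with W := (word l).reverse ++ m.W }.get) := by
    intro l
    induction l with
    | nil => intro m; rfl
    | cons a l ih =>
      intro m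
      simp only [word, List.map_cons, List.foldl_cons, s1] at ih ⊢
      simp [ih]
  have s2 : ∀ (a : Letter) (m : Mem), step N splitBody (⟨none, .done, ok, b⟩, m.get) (some a) =
      (⟨none, .done, ok, b⟩, { m with U := some a :: m.U }.get) := by
    intro a m; simp [splitBody]
  have h2 : ∀ (l : List Letter) (m : Mem), (word l).foldl (step N splitBody)
      (⟨none, .done, ok, b⟩, m.get) =
      (⟨none, .done, ok, b⟩, { m with U := (word l).reverse ++ m.U }.get) := by
    intro l
    induction l with
    | nil => intro m; rfl
    | cons a l ih =>
      intro m
      simp only [word, List.map_cons, List.foldl_cons, s2] at ih ⊢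
      simp [ih]
  have e : (pairCode (u, w)).reverse = word w.reverse ++ none :: word u.reverse := by
    simp [pairCode, word]
  rw [splitInput, eval_forEach (by simp [splitBody, Cmd.Avoids]) _ _ (by simpa using hN), e]
  simp only [Mem.get_X, Mem.update_X, List.foldl_append, List.foldl_cons, h1]
  have h3 : ∀ m : Mem, step N splitBody (⟨none, .outer, ok, b⟩, m.get) none =
      (⟨none, .done, ok, b⟩, m.get) := by
    intro m
    simp [splitBody]
  rw [h3, h2]
  simp [word]

/-! ### Reading the wiring -/

/-- The last bit of the list, if there is one, is set. -/
def Tight (l : List Bool) : Prop := ∀ n, (∀ i ∈ positions l, i < n) → l.length ≤ n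

theorem tight_nil : Tight [] := fun _ _ => Nat.zero_le _

theorem tight_append_true (l : List Bool) : Tight (l ++ [true]) := fun n h => by
  have := h l.length (by simp [positions_append])
  simpa using this

/-- The situation after a part `q` of the certificate has been read as a wiring. -/
def WiringInv (m₀ : Mem) (ok b : Bool) (q : List Letter) (s : State) : Prop :=
  s.1.mode = .fail ∨ ∃ (l : List Bool) (p y : Tape) (o : Mode),
    s = (⟨none, o, ok, b⟩, { m₀ with P := p, Y := y, B := (bits l).reverse }.get) ∧
    l.length ≤ q.length ∧
    ((o = .outer ∧ Tight l ∧ q = entries (positions l) ∧ p = [] ∧ y = []) ∨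
     (o = .arg ∧ Tight l ∧ q = entries (positions l) ++ [.cons] ∧ p = [] ∧ y = []) ∨
     (o = .lookup ∧ ∃ j, q = entries (positions l) ++ .cons :: .auto :: List.replicate j .tick ∧
        j + p.length = l.length ∧ y = []) ∨
     (o = .done ∧ Tight l ∧ ∃ rest, q = entries (positions l) ++ .nil :: rest ∧ p = [] ∧
        y = (word rest).reverse))

theorem wiringInv_step (m₀ : Mem) (ok b : Bool) (hT : m₀.T = []) (N : ℕ) (q : List Letter)
    (hq : q.length ≤ N) (s : State) (hs : WiringInv m₀ ok b q s) (a : Letter) :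
    WiringInv m₀ ok b (q ++ [a]) (step N wiringBody s (some a)) := by
  rcases hs with hs | ⟨l, p, y, o, rfl, hl, hs⟩
  · left
    obtain ⟨⟨cur, mode, ok', b'⟩, S⟩ := s
    simp only at hs
    subst hs
    simp [wiringBody]
  · have hl' : l.length ≤ (q ++ [a]).length := by simp; omega
    rcases hs with ⟨rfl, ht, hq', rfl, rfl⟩ | ⟨rfl, ht, hq', rfl, rfl⟩ |
      ⟨rfl, j, hq', hj, rfl⟩ | ⟨rfl, ht, rest, hq', rfl, rfl⟩
    · by_cases hc : a = .cons
      · subst hc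
        right
        refine ⟨l, [], [], .arg, by simp [wiringBody], hl', Or.inr (Or.inl ?_)⟩
        simp [hq', ht]
      · by_cases hn : a = .nil
        · subst hn
          right
          refine ⟨l, [], [], .done, by simp [wiringBody], hl', Or.inr (Or.inr (Or.inr ?_))⟩
          exact ⟨rfl, ht, [], by simp [hq', word]⟩
        · left
          simp [wiringBody, hc, hn]
    · by_cases hc : a = .auto
      · subst hc
        right
        refine ⟨l, (bits l).reverse, [], .lookup, ?_, hl', Or.inr (Or.inr (Or.inl ?_))⟩
        · have hB : (bits l).length ≤ N := by simp [bits]; omega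
          simp [wiringBody, eval_copy_get, hT, hB]
        · exact ⟨rfl, 0, by simp [hq', bits]⟩
      · left
        simp [wiringBody, hc]
    · by_cases hc : a = .tick
      · subst hc
        right
        cases p with
        | nil =>
          refine ⟨l ++ [false], [], [], .lookup, ?_, by simp; omega,
            Or.inr (Or.inr (Or.inl ?_))⟩
          · simp [wiringBody, bits]
          · refine ⟨rfl, j + 1, ?_, by simpa using hj, rfl⟩
            simp [hq', positions_append, List.replicate_succ']
        | cons d p =>
          refine ⟨l, p, [], .lookup, ?_, hl', Or.inr (Or.inr (Or.inl ?_))⟩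
          · simp [wiringBody]
          · refine ⟨rfl, j + 1, ?_, by simp at hj; omega, rfl⟩
            simp [hq', List.replicate_succ']
      · by_cases hn : a = .nil
        · subst hn
          cases p with
          | nil =>
            right
            refine ⟨l ++ [true], [], [], .outer, ?_, by simp; omega, Or.inl ?_⟩
            · simp [wiringBody, bits]
            · refine ⟨rfl, tight_append_true l, ?_, rfl, rfl⟩
              simp at hj
              simp [hq', positions_append, entries, encodeIdx_eq, hj]
          | cons d p =>
            left
            simp [wiringBody]
        · left
          simp [wiringBody, hc, hn]
    · right
      refine ⟨l, [], some a :: (word rest).reverse, .done, by simp [wiringBody], hl',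
        Or.inr (Or.inr (Or.inr ⟨rfl, ht, rest ++ [a], ?_⟩))⟩
      simp [hq', word]

theorem wiringInv_foldl (m₀ : Mem) (hT : m₀.T = []) (hP : m₀.P = []) (hY : m₀.Y = [])
    (hB : m₀.B = []) (N : ℕ) (q : List Letter) (hq : q.length ≤ N) (ok b : Bool) :
    WiringInv m₀ ok b q ((word q).foldl (step N wiringBody) (⟨none, .outer, ok, b⟩, m₀.get)) := by
  induction q using List.reverseRecOn with
  | nil =>
    right
    refine ⟨[], [], [], .outer, ?_, le_rfl, Or.inl ⟨rfl, tight_nil, rfl, rfl, rfl⟩⟩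
    obtain ⟨X, W, U, V, P, Q, T, A, B, Y, K, C⟩ := m₀
    simp only at hP hY hB
    subst hP hY hB
    rfl
  | append_singleton q a ih =>
    simp only [List.length_append, List.length_singleton] at hq
    simp only [word, List.map_append, List.map_cons, List.map_nil, List.foldl_append,
      List.foldl_cons, List.foldl_nil]
    exact wiringInv_step m₀ ok b hT N q (by omega) _ (ih (by omega)) a

/-- A strictly increasing list is read without rejection; `l` are the bits collected before. -/
theorem foldl_entries (ps : List ℕ) (hps : ps.Pairwise (· < ·)) (N : ℕ) (l : List Bool) (m : Mem)
    (hl : ∀ j ∈ ps, l.length ≤ j) (hT : m.T = []) (hP : m.P = []) (hB : m.B = (bits l).reverse)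
    (ok b : Bool) (hN : l.length + (entries ps).length ≤ N) :
    ∃ m' : Mem, (word (entries ps)).foldl (step N wiringBody) (⟨none, .outer, ok, b⟩, m.get) =
      (⟨none, .outer, ok, b⟩, m'.get) := by
  induction ps generalizing l m with
  | nil => exact ⟨m, rfl⟩
  | cons j ps ih =>
    rw [List.pairwise_cons] at hps
    have hj := hl j (by simp)
    obtain ⟨d, rfl⟩ := Nat.exists_eq_add_of_le hj
    have s1 : ∀ (a : Option Letter) (p : Tape) (m : Mem), m.P = a :: p →
        step N wiringBody (⟨none, .lookup, ok, b⟩, m.get) (some .tick) =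
        (⟨none, .lookup, ok, b⟩, { m with P := p }.get) := by
      intro a p m hm; simp [wiringBody, hm]
    have s2 : ∀ m : Mem, m.P = [] →
        step N wiringBody (⟨none, .lookup, ok, b⟩, m.get) (some .tick) =
        (⟨none, .lookup, ok, b⟩, { m with P := [], B := some (.bit false) :: m.B }.get) := by
      intro m hm; simp [wiringBody, hm]
    -- the bits below `l.length` are skipped
    have h1 : ∀ (p : Tape) (m : Mem), m.P = p → (word (List.replicate p.length .tick)).foldl
        (step N wiringBody) (⟨none, .lookup, ok, b⟩, m.get) =
        (⟨none, .lookup, ok, b⟩, { m with P := [] }.get) := by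
      intro p
      induction p with
      | nil =>
        intro m hm
        cases m
        simp only at hm
        subst hm
        rfl
      | cons a p ihp =>
        intro m hm
        simp only [word, List.length_cons, List.replicate_succ, List.map_cons, List.foldl_cons,
          s1 a p m hm] at ihp ⊢
        exact ihp { m with P := p } rfl
    -- the next `d` bits are set to zero
    have h2 : ∀ (d : ℕ) (m : Mem), m.P = [] → (word (List.replicate d .tick)).foldl
        (step N wiringBody) (⟨none, .lookup, ok, b⟩, m.get) =
        (⟨none, .lookup, ok, b⟩,
          { m with P := [], B := List.replicate d (some (Letter.bit false)) ++ m.B }.get) := by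
      intro d
      induction d with
      | zero =>
        intro m hm
        cases m
        simp only at hm
        subst hm
        rfl
      | succ d ihd =>
        intro m hm
        simp only [word, List.replicate_succ, List.map_cons, List.foldl_cons, s2 m hm] at ihd ⊢
        rw [ihd _ rfl]
        simp only [← List.replicate_succ, List.replicate_succ',
          List.append_assoc, List.singleton_append]
    have hlen : (entries ((l.length + d) :: ps)).length =
        3 + (l.length + d) + (entries ps).length := by
      simp [entries, encodeIdx_eq]; omega
    rw [hlen] at hN
    obtain ⟨m', h'⟩ := ih hps.2 (l ++ List.replicate d false ++ [true])
      { m with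
        P := []
        B := some (.bit true) :: (List.replicate d (some (Letter.bit false)) ++ m.B) }
      (fun i hi => by have := hps.1 i hi; simp; omega) hT rfl (by simp [bits, hB])
      (by simp; omega)
    refine ⟨m', ?_⟩
    have hrep : ∀ a b : ℕ, List.replicate (a + b) (some Letter.tick) =
        List.replicate a (some Letter.tick) ++ List.replicate b (some Letter.tick) :=
      fun a b => List.replicate_add _ _ _
    have e : word (entries ((l.length + d) :: ps)) = some .cons :: some .auto ::
        (word (List.replicate (bits l).reverse.length .tick) ++ (word (List.replicate d .tick) ++
          (some .nil :: word (entries ps)))) := by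
      have : (bits l).reverse.length = l.length := by simp [bits]
      rw [this]
      simp only [entries, encodeIdx_eq, word, List.flatMap_cons, List.map_append, List.map_cons,
        List.map_replicate, List.cons_append, List.append_assoc,
        List.nil_append, hrep]
    have h3 : step N wiringBody (step N wiringBody (⟨none, .outer, ok, b⟩, m.get) (some .cons))
        (some .auto) = (⟨none, .lookup, ok, b⟩, { m with P := (bits l).reverse }.get) := by
      have : (bits l).length ≤ N := by simp [bits]; omega
      simp [wiringBody, eval_copy_get, hT, this, hP, hB]
    rw [e, List.foldl_cons, List.foldl_cons, h3, List.foldl_append, h1 _ _ rfl, List.foldl_append,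
      h2 _ _ rfl, List.foldl_cons, ← h']
    simp [wiringBody]

theorem eval_readWiring_eq (w : List Letter) (N : ℕ) (hN : w.length ≤ N) (m₀ : Mem)
    (hW : m₀.W = word w) (o : Mode) (ok b : Bool) :
    readWiring.eval N (⟨none, o, ok, b⟩, m₀.get) =
      Cmd.eval N (.seq (.load fun v => {v with ok := decide (v.mode = .done)})
        (ifOk (.seq (pour .Y .W) (pour .B .V)))) ((word w).foldl (step N wiringBody)
          (⟨none, .outer, ok, b⟩, { m₀ with W := [] }.get)) := by
  have hav : wiringBody.Avoids .W := by simp [wiringBody, copy, pour, forEach, Cmd.Avoids]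
  have hrun : ∀ s, readWiring.eval N s = (Cmd.seq
      (.load fun v => {v with ok := decide (v.mode = .done)})
        (ifOk (.seq (pour .Y .W) (pour .B .V)))).eval N
        ((forEach .W wiringBody).eval N ((goMode .outer).eval N s)) := fun s => rfl
  have h0 : (goMode .outer).eval N (⟨none, o, ok, b⟩, m₀.get) =
    (⟨none, .outer, ok, b⟩, m₀.get) := rfl
  rw [hrun, h0, eval_forEach hav _ _ (by simpa [hW, word] using hN), Mem.get_W, hW, Mem.update_W]

/-- What a run of `readWiring` that does not reject tells about the certificate. -/
theorem eval_readWiring (w : List Letter) (N : ℕ) (hN : w.length ≤ N) (m₀ : Mem)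
    (hT : m₀.T = []) (hP : m₀.P = []) (hY : m₀.Y = []) (hB : m₀.B = []) (hV : m₀.V = [])
    (hW : m₀.W = word w) (o : Mode) (ok b : Bool) :
    (readWiring.eval N (⟨none, o, ok, b⟩, m₀.get)).1.ok =
      decide (((word w).foldl (step N wiringBody)
          (⟨none, .outer, ok, b⟩, { m₀ with W := [] }.get)).1.mode = .done) ∧
    ((readWiring.eval N (⟨none, o, ok, b⟩, m₀.get)).1.ok = true →
    ∃ (l : List Bool) (rest : List Letter), l.length ≤ w.length ∧ Tight l ∧
      w = entries (positions l) ++ .nil :: rest ∧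
      readWiring.eval N (⟨none, o, ok, b⟩, m₀.get) =
        (⟨none, .done, true, b⟩, { m₀ with W := word rest, V := bits l }.get)) := by
  have hinv := wiringInv_foldl { m₀ with W := [] } hT hP hY hB N w hN ok b
  rw [eval_readWiring_eq w N hN m₀ hW]
  rcases hinv with hs | ⟨l, p, y, o', hs, hl, hc⟩
  · simp [hs, ifOk]
  · rw [hs]
    rcases hc with ⟨rfl, -⟩ | ⟨rfl, -⟩ | ⟨rfl, -⟩ | ⟨rfl, ht, rest, hq, rfl, rfl⟩
    · simp [ifOk]
    · simp [ifOk]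
    · simp [ifOk]
    · have h1 : (word rest).length ≤ N := by
        rw [hq] at hN; simp [word] at hN ⊢; omega
      have h2 : (bits l).length ≤ N := by simp [bits]; omega
      refine ⟨by simp [ifOk, eval_pour_get, h1, h2, hV], fun _ => ⟨l, rest, hl, ht, hq, ?_⟩⟩
      simp [ifOk, eval_pour_get, h1, h2, hV]
      cases m₀
      simp_all

/-- Every strictly increasing list is accepted as a wiring. -/
theorem readWiring_entries (ps : List ℕ) (hps : ps.Pairwise (· < ·)) (rest : List Letter) (N : ℕ)
    (m₀ : Mem) (hT : m₀.T = []) (hP : m₀.P = []) (hY : m₀.Y = []) (hB : m₀.B = [])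
    (hV : m₀.V = []) (hW : m₀.W = word (entries ps ++ .nil :: rest))
    (hN : (entries ps ++ .nil :: rest).length ≤ N) (o : Mode) (ok b : Bool) :
    (readWiring.eval N (⟨none, o, ok, b⟩, m₀.get)).1.ok = true := by
  obtain ⟨m', hm⟩ := foldl_entries ps hps N [] { m₀ with W := [] } (by simp) hT hP
    (by simp [hB, bits]) ok b (by simp at hN ⊢; omega)
  have h1 : ∀ (l : List Letter) (m : Mem), ∃ m' : Mem, (word l).foldl (step N wiringBody)
      (⟨none, .done, ok, b⟩, m.get) = (⟨none, .done, ok, b⟩, m'.get) := by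
    intro l
    induction l with
    | nil => intro m; exact ⟨m, rfl⟩
    | cons a l ih =>
      intro m
      obtain ⟨m', h'⟩ := ih { m with Y := some a :: m.Y }
      refine ⟨m', h' ▸ ?_⟩
      rw [word, List.map_cons, List.foldl_cons]
      congr 1
      simp [wiringBody]
  obtain ⟨m'', hm''⟩ := h1 rest m'
  have h2 : step N wiringBody (⟨none, .outer, ok, b⟩, m'.get) (some .nil) =
      (⟨none, .done, ok, b⟩, m'.get) := by simp [wiringBody]
  have e : word (entries ps ++ .nil :: rest) = word (entries ps) ++ some .nil :: word rest := by
    simp [word]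
  rw [(eval_readWiring _ N hN m₀ hT hP hY hB hV hW o ok b).1, e, List.foldl_append, hm,
    List.foldl_cons, h2, hm'', decide_eq_true_eq]

theorem length_word (l : List Letter) : (word l).length = l.length := List.length_map _

theorem length_bits (l : List Bool) : (bits l).length = l.length := List.length_map _

theorem word_append (l l' : List Letter) : word (l ++ l') = word l ++ word l' := List.map_append

theorem word_cons (a : Letter) (l : List Letter) : word (a :: l) = some a :: word l := rfl

theorem eval_readSize (n : ℕ) (u : List Letter) (l : List Bool) (m : Mem) (N : ℕ)
    (hU : m.U = word (encodeIdx n ++ u)) (hV : m.V = bits l) (hQ : m.Q = []) (hB : m.B = [])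
    (hT : m.T = []) (hNU : (encodeIdx n ++ u).length ≤ N) (hNV : l.length ≤ N)
    (o : Mode) (ok b : Bool) :
    readSize.eval N (⟨none, o, ok, b⟩, m.get) = (⟨none, .done, decide (l.length ≤ n), b⟩,
      { m with U := word u, Q := (bits (l.drop n)).tail }.get) := by
  have hav : sizeBody.Avoids .U := by simp [sizeBody, Cmd.Avoids]
  have s1 : ∀ m : Mem, step N sizeBody (⟨none, .outer, ok, b⟩, m.get) (some .tick) =
      (⟨none, .outer, ok, b⟩, { m with Q := m.Q.tail }.get) := by intro m; simp [sizeBody]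
  have s2 : ∀ m : Mem, step N sizeBody (⟨none, .outer, ok, b⟩, m.get) (some .nil) =
      (⟨none, .done, ok, b⟩, m.get) := by intro m; simp [sizeBody]
  have s3 : ∀ (m : Mem) a, step N sizeBody (⟨none, .done, ok, b⟩, m.get) (some a) =
      (⟨none, .done, ok, b⟩, { m with B := some a :: m.B }.get) := by intro m a; simp [sizeBody]
  have h1 : ∀ (n : ℕ) (m : Mem), (word (encodeIdx n)).foldl (step N sizeBody)
      (⟨none, .outer, ok, b⟩, m.get) = (⟨none, .done, ok, b⟩, { m with Q := m.Q.drop n }.get) := by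
    intro n
    induction n with
    | zero => intro m; simp only [encodeIdx, word_cons, List.foldl_cons, s2]; rfl
    | succ n ih =>
      intro m
      simp only [encodeIdx, word_cons, List.foldl_cons, s1, ih]
      simp
  have h2 : ∀ (l : List Letter) (m : Mem), (word l).foldl (step N sizeBody)
      (⟨none, .done, ok, b⟩, m.get) =
      (⟨none, .done, ok, b⟩, { m with B := (word l).reverse ++ m.B }.get) := by
    intro l
    induction l with
    | nil => intro m; rfl
    | cons a l ih =>
      intro m
      simp only [word_cons, List.foldl_cons, s3, ih]
      simp
  have hr : ∀ s, readSize.eval N s = Cmd.eval N (.seq (pour .B .U) <|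
      .seq (read .Q) <| .load fun v => {v with ok := v.cur.isNone, cur := none})
      ((forEach .U sizeBody).eval N ((goMode .outer).eval N ((copy .V .Q).eval N s))) :=
    fun s => rfl
  have h0 : ∀ m : Mem, (goMode .outer).eval N (⟨none, o, ok, b⟩, m.get) =
    (⟨none, .outer, ok, b⟩, m.get) := fun m => rfl
  have hNV' : (bits l).length ≤ N := by rwa [length_bits]
  have hu : (word u).length ≤ N := by rw [length_word]; simp at hNU; omega
  rw [hr, eval_copy_get (by decide) (by decide) (by decide) _ _ (by simpa [hV] using hNV') hT]
  simp only [Mem.update_Q, h0]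
  rw [eval_forEach hav _ _ (by simpa [hU, length_word] using hNU)]
  simp only [Mem.get_U, hU, Mem.update_U, word_append, List.foldl_append, h1, h2]
  have hQ' : (bits l).drop n = bits (l.drop n) := by simp [bits]
  simp [eval_pour_get, hu, hB, hV, hQ, hQ']
  by_cases hln : l.length ≤ n
  · simp [hln, bits]
  · simp only [hln, decide_false]
    cases h : bits (l.drop n) with
    | nil => simp [bits] at h; omega
    | cons => rfl

/-! ### Substitution and comparison -/

/-- The name of a variable after the substitution of inputs for the variables in a list. -/
def substName (ps : List ℕ) (v : ℕ) : List Letter :=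
  if v ∈ ps then Letter.inp :: encodeIdx (ps.idxOf v) else Letter.auto :: encodeIdx v

/-- Reading the word `e`, the program `substitute` writes the word `e'`. -/
def Rewrites (N : ℕ) (l : List Bool) (e e' : List Letter) : Prop :=
  ∀ (m : Mem) (ok b : Bool), m.V = bits l → m.P = [] → m.Q = [] → m.C = [] → m.T = [] →
    (word e).foldl (step N substBody) (⟨none, .outer, ok, b⟩, m.get) =
      (⟨none, .outer, ok, b⟩, { m with Y := (word e').reverse ++ m.Y }.get)

section
variable {N : ℕ} {l : List Bool}

theorem Rewrites.nil : Rewrites N l [] [] := fun _ _ _ _ _ _ _ _ => rfl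

theorem Rewrites.append {e₁ e₁' e₂ e₂' : List Letter} (h₁ : Rewrites N l e₁ e₁')
    (h₂ : Rewrites N l e₂ e₂') : Rewrites N l (e₁ ++ e₂) (e₁' ++ e₂') := by
  intro m ok b hV hP hQ hC hT
  rw [word_append, List.foldl_append, h₁ m ok b hV hP hQ hC hT,
    h₂ { m with Y := (word e₁').reverse ++ m.Y } ok b hV hP hQ hC hT]
  simp [word_append]

theorem Rewrites.plain {a : Letter} (h : a ≠ .auto) (h' : ∀ b, a ≠ .bit b) :
    Rewrites N l [a] [a] := by
  intro m ok b hV hP hQ hC hT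
  simp [word, substBody, h, h']

theorem Rewrites.encodeIdx (j : ℕ) : Rewrites N l (encodeIdx j) (encodeIdx j) := by
  induction j with
  | zero => exact Rewrites.plain (by decide) (by decide)
  | succ j ih => exact (Rewrites.plain (a := .tick) (by decide) (by decide)).append ih

theorem Rewrites.encodeList {α : Type} {e e' : α → List Letter}
    (L : List α) (h : ∀ a ∈ L, Rewrites N l (e a) (e' a)) :
    Rewrites N l (encodeList e L) (encodeList e' L) := by
  induction L with
  | nil => exact Rewrites.plain (by decide) (by decide)
  | cons a L ih =>
    exact (Rewrites.plain (a := .cons) (by decide) (by decide)).append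
      ((h a (by simp)).append (ih fun a ha => h a (by simp [ha])))

/-- The names of variables are the only letters that are changed. -/
theorem Rewrites.name (hl : l.length ≤ N) (j : ℕ) (hj : j ≤ N) :
    Rewrites N l (.auto :: _root_.encodeIdx j) (substName (positions l) j) := by
  intro m ok b hV hP hQ hC hT
  have hl' : (bits l).length ≤ N := by rwa [length_bits]
  have h0 : step N substBody (⟨none, .outer, ok, b⟩, m.get) (some .auto) =
      (⟨none, .lookup, ok, b⟩, { m with P := bits l }.get) := by
    simp [substBody, eval_copy_get, hV, hl', hT, hP]
  have h1 : ∀ j, (word (List.replicate j .tick)).foldl (step N substBody)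
      (⟨none, .lookup, ok, b⟩, { m with P := bits l }.get) = (⟨none, .lookup, ok, b⟩,
        { m with
          P := bits (l.drop j)
          Q := word (List.replicate j .tick)
          C := word (List.replicate (positions (l.take j)).length .tick) }.get) := by
    intro j
    induction j with
    | zero =>
      cases m
      simp only at hQ hC
      subst hQ hC
      rfl
    | succ j ih =>
      rw [List.replicate_succ', word_append, List.foldl_append, ih]
      have hrep : word (List.replicate j .tick) ++ word [.tick] =
          some .tick :: word (List.replicate j .tick) := by
        rw [← word_append, ← List.replicate_succ', List.replicate_succ, word_cons]
      rw [hrep]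
      by_cases hjl : j < l.length
      · have hd : bits (l.drop j) = some (.bit l[j]) :: bits (l.drop (j + 1)) := by
          rw [List.drop_eq_getElem_cons hjl]; rfl
        have ht : (l.take j).length = j := by rw [List.length_take]; omega
        rw [← List.take_append_getElem hjl, positions_append, ht, hd]
        cases l[j]
        · simp [word_cons, substBody]
          simp [word]
        · simp [word_cons, substBody]
          simp [word, List.replicate_succ]
      · have hd : l.drop j = [] := List.drop_eq_nil_of_le (by omega)
        have hd' : l.drop (j + 1) = [] := List.drop_eq_nil_of_le (by omega)
        have ht : l.take j = l := List.take_of_length_le (by omega)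
        have ht' : l.take (j + 1) = l := List.take_of_length_le (by omega)
        rw [hd, hd', ht, ht']
        simp [word_cons, substBody, bits]
        simp [word]
  have hpos : (positions (l.take j)).length ≤ j := by
    refine (List.length_filter_le _ _).trans ?_
    simp
  have hQN : (word (List.replicate j Letter.tick)).length ≤ N := by
    rw [length_word, List.length_replicate]; exact hj
  have hCN : (word (List.replicate (positions (l.take j)).length Letter.tick)).length ≤ N := by
    rw [length_word, List.length_replicate]; omega
  have hrev : ∀ k : ℕ, (word (List.replicate k Letter.tick)).reverse =
      word (List.replicate k Letter.tick) := by intro k; simp [word]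
  have hPN : (bits (l.drop j)).tail.length ≤ N := by
    rw [List.length_tail, length_bits, List.length_drop]; omega
  have hhead : (bits (l.drop j)).head? = some (some (.bit true)) ↔ j ∈ positions l := by
    rw [mem_positions, List.getD_eq_getElem?_getD, bits, List.head?_map, List.head?_drop]
    cases l[j]? <;> simp
  have s1 : ∀ m : Mem, m.P.head? = some (some (.bit true)) → m.C.length ≤ N → m.Q.length ≤ N →
      m.P.length - 1 ≤ N → step N substBody (⟨none, .lookup, ok, b⟩, m.get) (some .nil) =
        (⟨none, .outer, ok, b⟩, { m with
          P := [], Q := [], C := []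
          Y := some .nil :: (m.C.reverse ++ some Letter.inp :: m.Y) }.get) := by
    intro m h h1 h2 h3
    simp [substBody, h]
    simp [eval_pour_get, eval_clear_get, h1, h2, h3]
  have s2 : ∀ m : Mem, m.P.head? ≠ some (some (.bit true)) → m.C.length ≤ N → m.Q.length ≤ N →
      m.P.length - 1 ≤ N → step N substBody (⟨none, .lookup, ok, b⟩, m.get) (some .nil) =
        (⟨none, .outer, ok, b⟩, { m with
          P := [], Q := [], C := []
          Y := some .nil :: (m.Q.reverse ++ some Letter.auto :: m.Y) }.get) := by
    intro m h h1 h2 h3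
    simp [substBody, h]
    simp [eval_pour_get, eval_clear_get, h1, h2, h3]
  have e : word [Letter.nil] = [some .nil] := rfl
  rw [word_cons, List.foldl_cons, h0, encodeIdx_eq, word_append, List.foldl_append, h1, e,
    List.foldl_cons, List.foldl_nil]
  rw [List.length_tail] at hPN
  by_cases hm : j ∈ positions l
  · rw [s1 _ (hhead.2 hm) hCN hQN hPN, substName, if_pos hm, idxOf_positions hm, encodeIdx_eq]
    simp [hrev, hP, hQ, hC, word_cons, word_append, e]
  · rw [s2 _ (mt hhead.1 hm) hCN hQN hPN, substName, if_neg hm, encodeIdx_eq]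
    simp [hrev, hP, hQ, hC, word_cons, word_append, e]

theorem Rewrites.circuit {n : ℕ} (hl : l.length ≤ N) (hn : n ≤ N) (C : Circuit (Fin n)) :
    Rewrites N l (encodeCircuit encodeFin C)
      (encodeCircuit (fun v : Fin n => substName (positions l) v) C) := by
  refine (Rewrites.encodeList _ fun G _ => ?_).append (Rewrites.encodeIdx _)
  cases G with
  | var a =>
    exact (Rewrites.plain (a := .var) (by decide) (by decide)).append
      (Rewrites.name hl a (a.2.le.trans hn))
  | conj p =>
    exact (Rewrites.plain (a := .conj) (by decide) (by decide)).append
      (Rewrites.encodeList _ fun j _ => Rewrites.encodeIdx j)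
  | disj p =>
    exact (Rewrites.plain (a := .disj) (by decide) (by decide)).append
      (Rewrites.encodeList _ fun j _ => Rewrites.encodeIdx j)
  | neg j =>
    exact (Rewrites.plain (a := .neg) (by decide) (by decide)).append (Rewrites.encodeIdx j)

end

theorem eval_substitute {n : ℕ} (Cs : List (Circuit (Fin n))) (k : List Bool) (l : List Bool)
    (N : ℕ) (hl : l.length ≤ N) (hn : n ≤ N) (m : Mem)
    (hU : m.U = word (encodeList (encodeCircuit encodeFin) Cs ++ k.map Letter.bit))
    (hUN : m.U.length ≤ N) (hV : m.V = bits l) (hX : m.X = []) (hP : m.P = []) (hQ : m.Q = [])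
    (hC : m.C = []) (hT : m.T = []) (hY : m.Y = []) (hK : m.K = []) (o : Mode) (ok b : Bool) :
    substitute.eval N (⟨none, o, ok, b⟩, m.get) = (⟨none, .outer, ok, b⟩, { m with
      Y := (word (encodeList
        (encodeCircuit fun v : Fin n => substName (positions l) v) Cs)).reverse
      K := (bits k).reverse }.get) := by
  have hav : substBody.Avoids .X := by
    simp [substBody, copy, pour, clear, forEach, Cmd.Avoids]
  have s1 : ∀ (m : Mem) c, step N substBody (⟨none, .outer, ok, b⟩, m.get) (some (.bit c)) =
      (⟨none, .outer, ok, b⟩, { m with K := some (.bit c) :: m.K }.get) := by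
    intro m c; cases c <;> simp [substBody]
  have h1 : ∀ (k : List Bool) (m : Mem), (bits k).foldl (step N substBody)
      (⟨none, .outer, ok, b⟩, m.get) =
      (⟨none, .outer, ok, b⟩, { m with K := (bits k).reverse ++ m.K }.get) := by
    intro k
    induction k with
    | nil => intro m; rfl
    | cons c k ih =>
      intro m
      have : bits (c :: k) = some (.bit c) :: bits k := rfl
      simp only [this, List.foldl_cons, s1, ih]
      simp
  have hbits : word (k.map Letter.bit) = bits k := by simp [word, bits]
  have hr : ∀ s, substitute.eval N s = (forEach .X substBody).eval N
      ((goMode .outer).eval N ((copy .U .X).eval N s)) := fun s => rfl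
  have h0 : ∀ m : Mem, (goMode .outer).eval N (⟨none, o, ok, b⟩, m.get) =
    (⟨none, .outer, ok, b⟩, m.get) := fun m => rfl
  rw [hr, eval_copy_get (by decide) (by decide) (by decide) _ _ hUN hT]
  simp only [Mem.update_X, h0, Mem.get_X, hX, List.append_nil, Mem.get_U]
  rw [eval_forEach hav _ _ hUN]
  simp only [Mem.get_X, Mem.update_X, hU, word_append, List.foldl_append, hbits]
  have h2 := Rewrites.encodeList Cs (fun C _ => Rewrites.circuit hl hn C)
    { m with X := [], U := word (encodeList (encodeCircuit encodeFin) Cs) ++ bits k } ok b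
    hV hP hQ hC hT
  simp only at h2
  rw [h2, h1]
  simp [hK, hY]

theorem eval_compare (e w : List Letter) (m : Mem) (N : ℕ) (hN : e.length ≤ N) (hX : m.X = [])
    (hY : m.Y = (word e).reverse) (hW : m.W = word w) (o : Mode) (ok b : Bool) :
    ∃ W' : Tape, compare.eval N (⟨none, o, ok, b⟩, m.get) =
      (⟨none, o, ok && decide (w = e), b⟩, { m with Y := [], W := W' }.get) := by
  have s1 : ∀ (m : Mem) a ok, step N compareBody (⟨none, o, ok, b⟩, m.get) a =
      (⟨none, o, ok && decide (m.W.head? = some a), b⟩, { m with W := m.W.tail }.get) := by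
    intro m a ok; simp [compareBody]
  have h1 : ∀ (e w : List Letter) (m : Mem) (ok : Bool), m.W = word w → ∃ W' : Tape,
      Cmd.eval N (.pop .W fun v o => {v with ok := v.ok && o.isNone} : Prog)
        ((word e).foldl (step N compareBody) (⟨none, o, ok, b⟩, m.get)) =
      (⟨none, o, ok && decide (w = e), b⟩, { m with W := W' }.get) := by
    intro e
    induction e with
    | nil =>
      intro w m ok hW
      refine ⟨(word w).tail, ?_⟩
      cases w <;> simp [word, hW]
    | cons a e ih =>
      intro w m ok hW
      rw [word_cons, List.foldl_cons, s1]
      cases w with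
      | nil =>
        obtain ⟨W', h⟩ := ih [] { m with W := [] } (ok && decide (m.W.head? = some (some a))) rfl
        refine ⟨W', ?_⟩
        simp only [hW, word, List.map_nil, List.tail_nil] at h ⊢
        rw [h]
        simp
      | cons c w =>
        obtain ⟨W', h⟩ := ih w { m with W := word w } (ok && decide (m.W.head? = some (some a))) rfl
        refine ⟨W', ?_⟩
        simp only [hW, word_cons, List.tail_cons] at h ⊢
        rw [h]
        simp [Bool.and_assoc]
  have hYN : m.Y.length ≤ N := by rw [hY, List.length_reverse, length_word]; exact hN
  have hr : ∀ s, compare.eval N s = Cmd.eval N (.pop .W fun v o =>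
      {v with ok := v.ok && o.isNone} : Prog) ((forEach .X compareBody).eval N
      ((pour .Y .X).eval N s)) := fun s => rfl
  obtain ⟨W', h⟩ := h1 e w { m with Y := [] } ok hW
  refine ⟨W', ?_⟩
  rw [hr, eval_pour_get (by decide) _ _ hYN]
  simp only [Mem.update_Y, Mem.update_X, Mem.get_Y, Mem.get_X, hX, List.append_nil]
  rw [eval_forEach (by simp [compareBody, Cmd.Avoids]) _ _ (by simpa using hYN)]
  simp only [Mem.update_X, Mem.get_X, hY, List.reverse_reverse]
  cases m
  simp only at hX
  subst hX
  exact h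

/-! ### The rounds of the acyclicity test -/

/-- The bits of all variables of a gate are set. -/
def gateOk {n : ℕ} (a : List Bool) : Gate (Fin n) → Bool
  | .var v => a.getD v false
  | _ => true

/-- The bits of all variables of a circuit are set. -/
def circuitOk {n : ℕ} (a : List Bool) (C : Circuit (Fin n)) : Bool :=
  C.gates.all (gateOk a)

/-- One round of the acyclicity test: the new bits, where `q` is the list of the membership bits
and `a` the list of the old bits. -/
def newBits {n : ℕ} (a : List Bool) : List (Circuit (Fin n)) → List Bool → List Bool
  | [], _ => []
  | C :: Cs, q => (q.headD false || circuitOk a C) :: newBits a Cs q.tail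

theorem length_newBits {n : ℕ} (a : List Bool) (Cs : List (Circuit (Fin n))) (q : List Bool) :
    (newBits a Cs q).length = Cs.length := by
  induction Cs generalizing q with
  | nil => rfl
  | cons C Cs ih => simp [newBits, ih]

theorem getD_newBits {n : ℕ} (a : List Bool) (Cs : List (Circuit (Fin n))) (q : List Bool)
    (i : ℕ) (hi : i < Cs.length) :
    (newBits a Cs q).getD i false = (q.getD i false || circuitOk a Cs[i]) := by
  induction Cs generalizing q i with
  | nil => simp at hi
  | cons C Cs ih =>
    cases i with
    | zero => cases q <;> simp [newBits]
    | succ i =>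
      have := ih q.tail i (by simpa using hi)
      cases q <;> simpa [newBits] using this

section
variable {N n : ℕ} {a : List Bool}

theorem relax_ticks (q : Mode) (hq : q = .pred ∨ q = .index ∨ q = .out) (j : ℕ) (ok c : Bool)
    (S : Reg → Tape) :
    (word (List.replicate j .tick)).foldl (step N relaxBody) (⟨none, q, ok, c⟩, S) =
      (⟨none, q, ok, c⟩, S) := by
  have h : step N relaxBody (⟨none, q, ok, c⟩, S) (some .tick) = (⟨none, q, ok, c⟩, S) := by
    rcases hq with rfl | rfl | rfl <;> simp [relaxBody, nextMode]
  induction j with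
  | zero => rfl
  | succ j ih => rw [List.replicate_succ, word_cons, List.foldl_cons, h, ih]

theorem relax_pred (j : ℕ) (ok c : Bool) (S : Reg → Tape) :
    (word (encodeIdx j)).foldl (step N relaxBody) (⟨none, .pred, ok, c⟩, S) =
      (⟨none, .preds, ok, c⟩, S) := by
  rw [encodeIdx_eq, word_append, List.foldl_append, relax_ticks _ (by simp)]
  simp [word, relaxBody, nextMode]

theorem relax_index (j : ℕ) (ok c : Bool) (S : Reg → Tape) :
    (word (encodeIdx j)).foldl (step N relaxBody) (⟨none, .index, ok, c⟩, S) =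
      (⟨none, .gates, ok, c⟩, S) := by
  rw [encodeIdx_eq, word_append, List.foldl_append, relax_ticks _ (by simp)]
  simp [word, relaxBody, nextMode]

theorem relax_preds (p : List ℕ) (ok c : Bool) (S : Reg → Tape) :
    (word (encodeList encodeIdx p)).foldl (step N relaxBody) (⟨none, .preds, ok, c⟩, S) =
      (⟨none, .gates, ok, c⟩, S) := by
  induction p with
  | nil => simp [encodeList, word, relaxBody, nextMode]
  | cons j p ih =>
    have h : step N relaxBody (⟨none, .preds, ok, c⟩, S) (some .cons) =
        (⟨none, .pred, ok, c⟩, S) := by simp [relaxBody, nextMode]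
    rw [encodeList, word_cons, word_append, List.foldl_cons, h, List.foldl_append, relax_pred, ih]

theorem relax_var (ha : a.length ≤ N) (m : Mem) (hA : m.A = bits a) (hP : m.P = [])
    (hT : m.T = []) (v : Fin n) (ok c : Bool) :
    (word (encodeFin v)).foldl (step N relaxBody) (⟨none, .arg, ok, c⟩, m.get) =
      (⟨none, .gates, ok, c && a.getD v false⟩, m.get) := by
  have ha' : (bits a).length ≤ N := by rwa [length_bits]
  have h0 : step N relaxBody (⟨none, .arg, ok, c⟩, m.get) (some .auto) =
      (⟨none, .lookup, ok, c⟩, { m with P := bits a }.get) := by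
    simp [relaxBody, eval_copy_get, hA, ha', hT, hP]
  have h1 : ∀ (j : ℕ) (m : Mem), (word (List.replicate j .tick)).foldl (step N relaxBody)
      (⟨none, .lookup, ok, c⟩, m.get) =
      (⟨none, .lookup, ok, c⟩, { m with P := m.P.drop j }.get) := by
    intro j
    induction j with
    | zero => intro m; rfl
    | succ j ih =>
      intro m
      have s1 : step N relaxBody (⟨none, .lookup, ok, c⟩, m.get) (some .tick) =
          (⟨none, .lookup, ok, c⟩, { m with P := m.P.tail }.get) := by simp [relaxBody]
      rw [List.replicate_succ, word_cons, List.foldl_cons, s1, ih]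
      simp
  have s2 : ∀ m : Mem, m.P.length ≤ N → step N relaxBody (⟨none, .lookup, ok, c⟩, m.get)
      (some .nil) = (⟨none, .gates, ok, c && decide (m.P.head? = some (some (.bit true)))⟩,
        { m with P := [] }.get) := by
    intro m hm
    have : m.P.length - 1 ≤ N := by omega
    simp [relaxBody, eval_clear_get, this]
  have e : word [Letter.nil] = [some .nil] := rfl
  have hPN : ((bits a).drop v).length ≤ N := by rw [List.length_drop]; omega
  have hhead : decide (((bits a).drop v).head? = some (some (.bit true))) = a.getD v false := by
    rw [List.head?_drop, List.getD_eq_getElem?_getD, bits, List.getElem?_map]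
    cases a[(v : ℕ)]? with
    | none => rfl
    | some d => cases d <;> rfl
  rw [encodeFin, word_cons, List.foldl_cons, h0, encodeIdx_eq, word_append, List.foldl_append, h1,
    e, List.foldl_cons, List.foldl_nil, s2 _ hPN, hhead]
  cases m
  simp only at hP
  subst hP
  rfl

theorem relax_gate (ha : a.length ≤ N) (m : Mem) (hA : m.A = bits a) (hP : m.P = [])
    (hT : m.T = []) (G : Gate (Fin n)) (ok c : Bool) :
    (word (encodeGate encodeFin G)).foldl (step N relaxBody) (⟨none, .head, ok, c⟩, m.get) =
      (⟨none, .gates, ok, c && gateOk a G⟩, m.get) := by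
  cases G with
  | var v =>
    have h : step N relaxBody (⟨none, .head, ok, c⟩, m.get) (some .var) =
        (⟨none, .arg, ok, c⟩, m.get) := by simp [relaxBody, nextMode]
    rw [encodeGate, word_cons, List.foldl_cons, h, relax_var ha m hA hP hT]
    rfl
  | conj p =>
    have h : step N relaxBody (⟨none, .head, ok, c⟩, m.get) (some .conj) =
        (⟨none, .preds, ok, c⟩, m.get) := by simp [relaxBody, nextMode]
    rw [encodeGate, word_cons, List.foldl_cons, h, relax_preds]
    simp [gateOk]
  | disj p =>
    have h : step N relaxBody (⟨none, .head, ok, c⟩, m.get) (some .disj) =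
        (⟨none, .preds, ok, c⟩, m.get) := by simp [relaxBody, nextMode]
    rw [encodeGate, word_cons, List.foldl_cons, h, relax_preds]
    simp [gateOk]
  | neg j =>
    have h : step N relaxBody (⟨none, .head, ok, c⟩, m.get) (some .neg) =
        (⟨none, .index, ok, c⟩, m.get) := by simp [relaxBody, nextMode]
    rw [encodeGate, word_cons, List.foldl_cons, h, relax_index]
    simp [gateOk]

theorem relax_gates (ha : a.length ≤ N) (m : Mem) (hA : m.A = bits a) (hP : m.P = [])
    (hT : m.T = []) (L : List (Gate (Fin n))) (ok c : Bool) :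
    (word (encodeList (encodeGate encodeFin) L)).foldl (step N relaxBody)
      (⟨none, .gates, ok, c⟩, m.get) = (⟨none, .out, ok, c && L.all (gateOk a)⟩, m.get) := by
  induction L generalizing c with
  | nil => simp [encodeList, word, relaxBody, nextMode]
  | cons G L ih =>
    have h : step N relaxBody (⟨none, .gates, ok, c⟩, m.get) (some .cons) =
        (⟨none, .head, ok, c⟩, m.get) := by simp [relaxBody, nextMode]
    rw [encodeList, word_cons, word_append, List.foldl_cons, h, List.foldl_append,
      relax_gate ha m hA hP hT, ih, List.all_cons, Bool.and_assoc]

theorem relax_circuit (ha : a.length ≤ N) (m : Mem) (hA : m.A = bits a) (hP : m.P = [])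
    (hT : m.T = []) (q : List Bool) (hQ : m.Q = bits q) (C : Circuit (Fin n)) (ok : Bool) :
    (word (encodeCircuit encodeFin C)).foldl (step N relaxBody)
      (⟨none, .gates, ok, true⟩, m.get) = (⟨none, .outer, ok, true⟩, { m with
        Q := bits q.tail
        B := some (.bit (q.headD false || circuitOk a C)) :: m.B }.get) := by
  have h : ∀ c, step N relaxBody (⟨none, .out, ok, c⟩, m.get) (some .nil) =
      (⟨none, .outer, ok, true⟩, { m with
        Q := bits q.tail
        B := some (.bit (q.headD false || c)) :: m.B }.get) := by
    intro c
    rcases q with _ | ⟨_ | _, q⟩ <;> simp [relaxBody, hQ, bits]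
  have e : word [Letter.nil] = [some .nil] := rfl
  rw [encodeCircuit, word_append, List.foldl_append, relax_gates ha m hA hP hT, encodeIdx_eq,
    word_append, List.foldl_append, relax_ticks _ (by simp), e, List.foldl_cons, h, Bool.true_and]
  rfl

theorem relax_circuits (ha : a.length ≤ N) (m : Mem) (hA : m.A = bits a) (hP : m.P = [])
    (hT : m.T = []) (q : List Bool) (hQ : m.Q = bits q) (Cs : List (Circuit (Fin n))) (ok : Bool) :
    (word (encodeList (encodeCircuit encodeFin) Cs)).foldl (step N relaxBody)
      (⟨none, .outer, ok, true⟩, m.get) = (⟨none, .done, ok, true⟩, { m with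
        Q := bits (q.drop Cs.length)
        B := (bits (newBits a Cs q)).reverse ++ m.B }.get) := by
  induction Cs generalizing q m with
  | nil =>
    have h : step N relaxBody (⟨none, .outer, ok, true⟩, m.get) (some .nil) =
        (⟨none, .done, ok, true⟩, m.get) := by simp [relaxBody, nextMode]
    rw [encodeList, word_cons, List.foldl_cons, h]
    cases m
    simp only at hQ
    subst hQ
    rfl
  | cons C Cs ih =>
    have h : step N relaxBody (⟨none, .outer, ok, true⟩, m.get) (some .cons) =
        (⟨none, .gates, ok, true⟩, m.get) := by simp [relaxBody, nextMode]
    have hih := ih { m with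
        Q := bits q.tail
        B := some (.bit (q.headD false || circuitOk a C)) :: m.B } hA hP hT q.tail rfl
    rw [encodeList, word_cons, word_append, List.foldl_cons, h, List.foldl_append,
      relax_circuit ha m hA hP hT q hQ, hih]
    simp [newBits, bits]

end

theorem eval_relax {n : ℕ} (Cs : List (Circuit (Fin n))) (k l a : List Bool) (N : ℕ)
    (ha : a.length ≤ N) (hl : l.length ≤ Cs.length) (hCs : Cs.length ≤ N) (m : Mem)
    (hU : m.U = word (encodeList (encodeCircuit encodeFin) Cs ++ k.map Letter.bit))
    (hUN : m.U.length ≤ N) (hV : m.V = bits l) (hA : m.A = bits a) (hX : m.X = [])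
    (hP : m.P = []) (hQ : m.Q = []) (hT : m.T = []) (hB : m.B = []) (o : Mode) (ok b : Bool) :
    relax.eval N (⟨none, o, ok, b⟩, m.get) =
      (⟨none, .done, ok, true⟩, { m with A := bits (newBits a Cs l) }.get) := by
  have hav : relaxBody.Avoids .X := by
    simp [relaxBody, copy, pour, clear, forEach, Cmd.Avoids]
  have s1 : ∀ (S : Reg → Tape) c, step N relaxBody (⟨none, .done, ok, true⟩, S) (some (.bit c)) =
      (⟨none, .done, ok, true⟩, S) := by
    intro m c; simp [relaxBody, nextMode]
  have h1 : ∀ (k : List Bool) (S : Reg → Tape), (word (k.map Letter.bit)).foldl (step N relaxBody)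
      (⟨none, .done, ok, true⟩, S) = (⟨none, .done, ok, true⟩, S) := by
    intro k
    induction k with
    | nil => intro S; rfl
    | cons c k ih => intro S; rw [List.map_cons, word_cons, List.foldl_cons, s1, ih]
  have hr : ∀ s, relax.eval N s = (Cmd.seq (clear .A) (pour .B .A)).eval N
      ((forEach .X relaxBody).eval N
        (Cmd.eval N (.load fun v => {v with bit := true, mode := .outer})
          ((copy .V .Q).eval N ((copy .U .X).eval N s)))) := fun s => rfl
  have h0 : ∀ m : Mem, Cmd.eval N (.load fun v => {v with bit := true, mode := .outer} : Prog)
    (⟨none, o, ok, b⟩, m.get) = (⟨none, .outer, ok, true⟩, m.get) := fun m => rfl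
  have hlN : (bits l).length ≤ N := by rw [length_bits]; omega
  have haN : (bits a).length ≤ N := by rwa [length_bits]
  have hnN : (bits (newBits a Cs l)).length ≤ N := by rwa [length_bits, length_newBits]
  have hd : bits (l.drop Cs.length) = [] := by rw [List.drop_eq_nil_of_le hl]; rfl
  rw [hr, eval_copy_get (by decide) (by decide) (by decide) _ _ hUN hT]
  simp only [Mem.update_X, Mem.get_X, hX, List.append_nil, Mem.get_U]
  rw [eval_copy_get (by decide) (by decide) (by decide) _ { m with X := m.U }
    (by simpa [hV] using hlN) hT]
  simp only [Mem.update_Q, Mem.get_Q, hQ, List.append_nil, Mem.get_V, h0]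
  rw [eval_forEach hav _ _ hUN]
  have hc := relax_circuits ha { m with X := [], Q := bits l } hA hP hT l rfl Cs ok
  simp only [hU, hV, word_append] at hc
  simp only [Mem.get_X, Mem.update_X, hU, hV, word_append, List.foldl_append, hc, h1]
  simp [eval_clear_get, eval_pour_get, hA, haN, hnN, hB, hd]

theorem eval_relaxAll {n : ℕ} (Cs : List (Circuit (Fin n))) (k l : List Bool) (N : ℕ)
    (hl : l.length ≤ Cs.length) (hCs : Cs.length ≤ N) (m : Mem)
    (hU : m.U = word (encodeList (encodeCircuit encodeFin) Cs ++ k.map Letter.bit))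
    (hUN : m.U.length ≤ N) (hV : m.V = bits l) (hA : m.A = []) (hX : m.X = [])
    (hP : m.P = []) (hQ : m.Q = []) (hT : m.T = []) (hB : m.B = []) (o : Mode) (ok b : Bool) :
    ∃ o' b', relaxAll.eval N (⟨none, o, ok, b⟩, m.get) = (⟨none, o', ok, b'⟩,
      { m with A := bits ((fun a => newBits a Cs l)^[N] l) }.get) := by
  have hlN : (bits l).length ≤ N := by rw [length_bits]; omega
  have key : ∀ i, ∃ o' b', (relax.eval N)^[i] (⟨none, o, ok, b⟩, { m with A := bits l }.get) =
      (⟨none, o', ok, b'⟩, { m with A := bits ((fun a => newBits a Cs l)^[i] l) }.get) := by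
    intro i
    induction i with
    | zero => exact ⟨o, b, rfl⟩
    | succ i ih =>
      obtain ⟨o', b', ih⟩ := ih
      have hlen : ((fun a => newBits a Cs l)^[i] l).length ≤ N := by
        cases i with
        | zero => exact hl.trans hCs
        | succ i => rw [Function.iterate_succ_apply', length_newBits]; exact hCs
      refine ⟨.done, true, ?_⟩
      rw [Function.iterate_succ_apply', ih, Function.iterate_succ_apply',
        eval_relax Cs k l _ N hlen hl hCs
          { m with A := bits ((fun a => newBits a Cs l)^[i] l) } hU hUN hV rfl hX hP hQ hT hB]
  obtain ⟨o', b', h⟩ := key N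
  refine ⟨o', b', ?_⟩
  rw [← h, relaxAll, Cmd.eval, Cmd.eval,
    eval_copy_get (by decide) (by decide) (by decide) _ _ (by simpa [hV] using hlN) hT]
  simp only [Mem.update_A, Mem.get_A, hA, List.append_nil, Mem.get_V, hV]

/-! ### Comparison with the bound -/

/-- The value of a binary number, least significant bit first. -/
def value : List Bool → ℕ
  | [] => 0
  | b :: l => b.toNat + 2 * value l

/-- Decrement of a binary number, and whether this was possible; from zero the result is junk. -/
def pred : List Bool → List Bool × Bool
  | [] => ([], false)
  | true :: l => (false :: l, true)
  | false :: l => (true :: (pred l).1, (pred l).2)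

theorem length_pred (l : List Bool) : (pred l).1.length = l.length := by
  induction l with
  | nil => rfl
  | cons b l ih => cases b <;> simp [pred, ih]

theorem pred_spec (l : List Bool) :
    (value l = 0 ∧ (pred l).2 = false) ∨ ((pred l).2 = true ∧ value (pred l).1 + 1 = value l) := by
  induction l with
  | nil => simp [value, pred]
  | cons b l ih =>
    cases b
    · simp only [value, pred, Bool.toNat_false, Bool.toNat_true]
      rcases ih with ⟨h1, h2⟩ | ⟨h1, h2⟩
      · exact Or.inl ⟨by omega, h2⟩
      · exact Or.inr ⟨h1, by omega⟩
    · refine Or.inr ⟨rfl, ?_⟩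
      simp only [value, pred, Bool.toNat_false, Bool.toNat_true]
      omega

theorem value_encodeNat (k : ℕ) : value (Computability.encodeNat k) = k := by
  have h : ∀ p : PosNum, value (Computability.encodePosNum p) = p := by
    intro p
    induction p with
    | one => rfl
    | bit0 p ih => simp [Computability.encodePosNum, value, ih]; omega
    | bit1 p ih => simp [Computability.encodePosNum, value, ih]; omega
  unfold Computability.encodeNat Computability.encodeNum
  have hk : ((k : Num) : ℕ) = k := Num.to_of_nat k
  generalize (k : Num) = x at hk
  subst hk
  cases x with
  | zero => rfl
  | pos p => exact h p

theorem eval_decrement (x : List Bool) (N : ℕ) (hN : x.length ≤ N) (m : Mem) (hX : m.X = bits x)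
    (hT : m.T = []) (c : Option (Option Letter)) (o : Mode) (ok b : Bool) :
    ∃ o', decrement.eval N (⟨c, o, ok, b⟩, m.get) =
      (⟨none, o', ok && (pred x).2, b⟩, { m with X := bits (pred x).1 }.get) := by
  have hav : decrementBody.Avoids .X := by simp [decrementBody, Cmd.Avoids]
  have h1 : ∀ (x : List Bool) (m : Mem), (bits x).foldl (step N decrementBody)
      (⟨none, .done, ok, b⟩, m.get) =
      (⟨none, .done, ok, b⟩, { m with T := (bits x).reverse ++ m.T }.get) := by
    intro x
    induction x with
    | nil => intro m; rfl
    | cons d x ih =>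
      intro m
      have s1 : step N decrementBody (⟨none, .done, ok, b⟩, m.get) (some (.bit d)) =
          (⟨none, .done, ok, b⟩, { m with T := some (.bit d) :: m.T }.get) := by
        simp [decrementBody]
      have e : bits (d :: x) = some (.bit d) :: bits x := rfl
      rw [e, List.foldl_cons, s1, ih]
      simp
  have h2 : ∀ (x : List Bool) (m : Mem), (bits x).foldl (step N decrementBody)
      (⟨none, .outer, ok, b⟩, m.get) = (⟨none, if (pred x).2 then .done else .outer, ok, b⟩,
        { m with T := (bits (pred x).1).reverse ++ m.T }.get) := by
    intro x
    induction x with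
    | nil => intro m; rfl
    | cons d x ih =>
      intro m
      have e : ∀ d x, bits (d :: x) = some (.bit d) :: bits x := fun d x => rfl
      cases d
      · have s1 : step N decrementBody (⟨none, .outer, ok, b⟩, m.get) (some (.bit false)) =
            (⟨none, .outer, ok, b⟩, { m with T := some (.bit true) :: m.T }.get) := by
          simp [decrementBody]
        rw [e, List.foldl_cons, s1, ih]
        simp only [pred, e, List.reverse_cons, List.append_assoc, List.singleton_append]
        rfl
      · have s1 : step N decrementBody (⟨none, .outer, ok, b⟩, m.get) (some (.bit true)) =
            (⟨none, .done, ok, b⟩, { m with T := some (.bit false) :: m.T }.get) := by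
          simp [decrementBody]
        rw [e, List.foldl_cons, s1, h1]
        simp only [pred, e, List.reverse_cons, List.append_assoc, List.singleton_append, if_true]
  have hr : ∀ s, decrement.eval N s = (Cmd.seq (pour .T .X)
      (.load fun v => {v with ok := v.ok && decide (v.mode = .done)})).eval N
      ((forEach .X decrementBody).eval N ((goMode .outer).eval N s)) := fun s => rfl
  have hxN : (bits x).length ≤ N := by rwa [length_bits]
  have hpN : (bits (pred x).1).length ≤ N := by rwa [length_bits, length_pred]
  have h0 : (goMode .outer).eval N (⟨c, o, ok, b⟩, m.get) = (⟨c, .outer, ok, b⟩, m.get) := rfl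
  refine ⟨if (pred x).2 then .done else .outer, ?_⟩
  rw [hr, h0, eval_forEach hav _ _ (by simpa [hX] using hxN)]
  simp only [Mem.get_X, Mem.update_X, hX, h2]
  simp [eval_pour_get, hpN, hT]

theorem eval_count (k l : List Bool) (N : ℕ) (hk : k.length ≤ N) (hl : l.length ≤ N) (m : Mem)
    (hK : m.K = (bits k).reverse) (hX : m.X = []) (hV : m.V = bits l) (hT : m.T = [])
    (o : Mode) (ok b : Bool) :
    ∃ o' x, count.eval N (⟨none, o, ok, b⟩, m.get) =
      (⟨none, o', ok && decide (l.count true ≤ value k), b⟩,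
        { m with K := [], V := [], X := x }.get) := by
  have hav : countBody.Avoids .V := by
    simp [countBody, decrement, decrementBody, pour, forEach, Cmd.Avoids]
  have h1 : ∀ (l x : List Bool) (m : Mem) (o : Mode) (ok : Bool), x.length ≤ N → m.X = bits x →
      m.T = [] → ∃ o' x', (bits l).foldl (step N countBody) (⟨none, o, ok, b⟩, m.get) =
      (⟨none, o', ok && decide (l.count true ≤ value x), b⟩, { m with X := x' }.get) := by
    intro l
    induction l with
    | nil => intro x m o ok _ _ _; exact ⟨o, m.X, by simp [bits]⟩
    | cons d l ih =>
      intro x m o ok hx hX hT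
      have e : bits (d :: l) = some (.bit d) :: bits l := rfl
      cases d
      · obtain ⟨o', x', h⟩ := ih x m o ok hx hX hT
        have s1 : step N countBody (⟨none, o, ok, b⟩, m.get) (some (.bit false)) =
            (⟨none, o, ok, b⟩, m.get) := by simp [countBody]
        refine ⟨o', x', ?_⟩
        rw [e, List.foldl_cons, s1, h]
        simp
      · obtain ⟨o₁, hd⟩ := eval_decrement x N hx m hX hT (some (some (.bit true))) o ok b
        have s1 : step N countBody (⟨none, o, ok, b⟩, m.get) (some (.bit true)) =
            (⟨none, o₁, ok && (pred x).2, b⟩, { m with X := bits (pred x).1 }.get) := by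
          simp [countBody, hd]
        obtain ⟨o', x', h⟩ := ih (pred x).1 { m with X := bits (pred x).1 } o₁ (ok && (pred x).2)
          (by rwa [length_pred]) rfl hT
        refine ⟨o', x', ?_⟩
        rw [e, List.foldl_cons, s1, h]
        refine Prod.ext ?_ rfl
        simp only [List.count_cons_self, Control.mk.injEq, true_and, and_true, Bool.and_assoc]
        congr 1
        rcases pred_spec x with ⟨h3, h4⟩ | ⟨h3, h4⟩
        · simp [h3, h4]
        · rw [h3, Bool.true_and, ← h4]
          simp
  have hr : ∀ s, count.eval N s = (forEach .V countBody).eval N ((pour .K .X).eval N s) :=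
    fun s => rfl
  have hkN : (bits k).reverse.length ≤ N := by rwa [List.length_reverse, length_bits]
  have hlN : (bits l).length ≤ N := by rwa [length_bits]
  obtain ⟨o', x', h⟩ := h1 l k { m with K := [], V := [], X := bits k } o ok hk rfl hT
  refine ⟨o', x', ?_⟩
  rw [hr, eval_pour_get (by decide) _ _ (by simpa [hK] using hkN)]
  simp only [Mem.update_K, Mem.update_X, Mem.get_K, Mem.get_X, hK, hX, List.reverse_reverse,
    List.append_nil]
  rw [eval_forEach hav _ _ (by simpa [hV] using hlN)]
  simp only [Mem.get_V, Mem.update_V, hV]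
  exact h

theorem eval_allSet (a : List Bool) (N : ℕ) (ha : a.length ≤ N) (m : Mem) (hA : m.A = bits a)
    (o : Mode) (ok b : Bool) :
    (allSet.eval N (⟨none, o, ok, b⟩, m.get)).1.ok = (ok && a.all id) := by
  have hav : allBody.Avoids .A := by simp [allBody, Cmd.Avoids]
  have h1 : ∀ (a : List Bool) (S : Reg → Tape) (ok : Bool), ((bits a).foldl (step N allBody)
      (⟨none, o, ok, b⟩, S)).1.ok = (ok && a.all id) := by
    intro a
    induction a with
    | nil => intro S ok; simp [bits]
    | cons d a ih =>
      intro S ok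
      have s1 : step N allBody (⟨none, o, ok, b⟩, S) (some (.bit d)) =
          (⟨none, o, ok && d, b⟩, S) := by cases d <;> simp [allBody]
      have e : bits (d :: a) = some (.bit d) :: bits a := rfl
      rw [e, List.foldl_cons, s1, ih]
      simp [Bool.and_assoc]
  have haN : (bits a).length ≤ N := by rwa [length_bits]
  rw [allSet, eval_forEach hav _ _ (by simpa [hA] using haN), Mem.get_A, hA]
  exact h1 a _ ok

end Verifier

/-! ### Circuits, renamings and their encodings -/

namespace Circuit

variable {A B : Type}

theorem eval_rename (g : A → B) (C : Circuit A) (x : B → Bool) :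
    (C.rename g).eval x = C.eval (x ∘ g) := by
  have h : ∀ G : Gate A, (G.rename g).eval x = G.eval (x ∘ g) := by
    intro G
    cases G <;> rfl
  have h' : (C.rename g).values x = C.values (x ∘ g) := by
    simp only [values, rename, List.foldl_map]
    congr 1
    funext v G
    cases G <;> rfl
  rw [eval, h']
  rfl

theorem rename_rename {D : Type} (g : A → B) (h : B → D) (C : Circuit A) :
    (C.rename g).rename h = C.rename (h ∘ g) := by
  obtain ⟨L, o, _, _⟩ := C
  simp only [rename, List.map_map, mk.injEq, and_true]
  refine List.map_congr_left fun G _ => ?_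
  cases G <;> rfl

theorem occurs_rename {g : A → B} {C : Circuit A} {b : B} :
    (C.rename g).Occurs b ↔ ∃ a, C.Occurs a ∧ g a = b := by
  unfold Occurs rename
  rw [List.mem_map]
  constructor
  · rintro ⟨G, hG, h⟩
    cases G <;> simp_all [Gate.rename]
    exact ⟨_, hG, h⟩
  · rintro ⟨a, ha, rfl⟩
    exact ⟨_, ha, rfl⟩

theorem eval_congr {C : Circuit A} {x y : A → Bool} (h : ∀ a, C.Occurs a → x a = y a) :
    C.eval x = C.eval y := by
  have hv : C.values x = C.values y := by
    unfold values
    refine List.foldl_ext _ _ _ fun v G hG => ?_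
    cases G with
    | var a => simp [Gate.eval, h a hG]
    | _ => rfl
  rw [eval, hv, eval]

theorem occurs_of_influences {C : Circuit A} {a : A} (h : Influences C.eval a) : C.Occurs a := by
  obtain ⟨x, y, hne, hxy⟩ := h
  by_contra ha
  refine hne (eval_congr fun b hb => (hxy b).1 ?_)
  rintro rfl
  exact ha hb

end Circuit

theorem encodeList_congr {α β : Type} {e : α → List Letter} {e' : β → List Letter} {l : List α}
    {l' : List β} (h : l.map e = l'.map e') : encodeList e l = encodeList e' l' := by
  induction l generalizing l' with
  | nil =>
    cases l' with
    | nil => rfl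
    | cons b l' => simp at h
  | cons a l ih =>
    cases l' with
    | nil => simp at h
    | cons b l' =>
      simp only [List.map_cons, List.cons.injEq] at h
      rw [encodeList, encodeList, h.1, ih h.2]

theorem encodeCircuit_rename {A B : Type} (e : B → List Letter) (g : A → B) (C : Circuit A) :
    encodeCircuit e (C.rename g) = encodeCircuit (e ∘ g) C := by
  unfold encodeCircuit
  congr 1
  refine encodeList_congr ?_
  rw [Circuit.rename, List.map_map]
  refine List.map_congr_left fun G _ => ?_
  cases G <;> rfl

theorem length_encodeList_le {α : Type} {e e' : α → List Letter}
    (h : ∀ a, (e a).length ≤ (e' a).length) (l : List α) :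
    (encodeList e l).length ≤ (encodeList e' l).length := by
  induction l with
  | nil => exact le_rfl
  | cons a l ih =>
    have := h a
    simp only [encodeList, List.length_cons, List.length_append]
    omega

theorem length_encodeCircuit_le {A : Type} {e e' : A → List Letter}
    (h : ∀ a, (e a).length ≤ (e' a).length) (C : Circuit A) :
    (encodeCircuit e C).length ≤ (encodeCircuit e' C).length := by
  unfold encodeCircuit
  rw [List.length_append, List.length_append]
  refine Nat.add_le_add_right (length_encodeList_le (fun G => ?_) _) _
  cases G with
  | var a => simpa [encodeGate] using h a
  | _ => exact le_rfl

theorem length_encodeIdx (j : ℕ) : (encodeIdx j).length = j + 1 := by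
  simp [Verifier.encodeIdx_eq]

theorem Wiring.subst_of_eq_some {S I : Type} {ω : Wiring S I} {i : I} {s : S}
    (h : ω i = some s) : ω.subst (Sum.inr i) = Sum.inl s := by
  simp only [Wiring.subst]
  split
  · rename_i t ht
    rw [ht] at h
    rw [Option.some.inj h]
  · rename_i ht
    rw [ht] at h
    cases h

theorem SyntacticEq.eqBAN {n m : ℕ} {ω : Wiring (Fin n) (Fin m)} {M : ModuleCode n m}
    {F : BANCode n} (h : SyntacticEq ω M F) : (ω.apply M.toModule).EqBAN F.toBAN := by
  refine ⟨h.1, fun s x => ?_⟩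
  have := congrArg (fun C => C.eval x) (h.2 s)
  simp only [Circuit.eval_rename] at this
  exact this

/-! ### Unfolding a network at a list of automata -/

section Unfold

variable {n : ℕ}

/-- The arcs of the digraph of variable occurrences that do not start in the list `ps`. -/
def Arc (F : BANCode n) (ps : List ℕ) (s t : Fin n) : Prop :=
  (s : ℕ) ∉ ps ∧ (F t).Occurs s

/-- The name of a variable after the automata of the list `ps` were replaced by inputs. -/
def cutName (ps : List ℕ) (v : Fin n) : Fin n ⊕ Fin ps.length :=
  if h : (v : ℕ) ∈ ps then Sum.inr ⟨ps.idxOf (v : ℕ), List.idxOf_lt_length_of_mem h⟩ else Sum.inl v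

/-- The module obtained from a network by replacing the automata of the list `ps` by inputs, with
the wiring that undoes this. -/
def cut (F : BANCode n) (ps : List ℕ) (hps : ∀ j ∈ ps, j < n) : UnfoldingCandidate n where
  m := ps.length
  ω i := some ⟨ps[i], hps _ (List.getElem_mem _)⟩
  M t := (F t).rename (cutName ps)

variable {F : BANCode n} {ps : List ℕ} {hps : ∀ j ∈ ps, j < n}

theorem encode_cut : (cut F ps hps).encode = Verifier.entries ps ++ .nil ::
    encodeList (encodeCircuit fun v : Fin n => Verifier.substName ps v) (List.ofFn F) := by
  have h1 : encodeList encodeOption (List.ofFn (cut F ps hps).ω) =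
      Verifier.entries ps ++ [.nil] := by
    rw [← Verifier.encodeList_eq_entries]
    refine encodeList_congr ?_
    rw [List.map_ofFn]
    refine List.ext_getElem (by simp [cut]) fun i _ _ => ?_
    simp [cut, encodeOption, encodeFin]
  have h2 : encodeList (encodeCircuit encodeSum) (List.ofFn (cut F ps hps).M) =
      encodeList (encodeCircuit fun v : Fin n => Verifier.substName ps v) (List.ofFn F) := by
    refine encodeList_congr ?_
    rw [List.map_ofFn, List.map_ofFn]
    congr 1
    funext t
    refine (encodeCircuit_rename _ _ _).trans ?_
    change encodeCircuit _ (F t) = encodeCircuit _ (F t)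
    congr 1
    funext v
    change encodeSum (m := ps.length) (cutName ps v) = _
    rw [cutName, Verifier.substName]
    split <;> rfl
  rw [UnfoldingCandidate.encode, h1, h2]
  simp

theorem syntacticEq_cut : SyntacticEq (cut F ps hps).ω (cut F ps hps).M F := by
  refine ⟨⟨fun i => by have := i.2; simp [cut] at this⟩, fun s => ?_⟩
  refine (Circuit.rename_rename _ _ _).trans ?_
  congr 1
  funext v
  change (cut F ps hps).ω.subst (cutName ps v) = Sum.inl v
  by_cases h : (v : ℕ) ∈ ps
  · have e : cutName ps v = Sum.inr ⟨_, List.idxOf_lt_length_of_mem h⟩ := dif_pos h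
    rw [e]
    exact Wiring.subst_of_eq_some (by simp [cut])
  · have e : cutName ps v = Sum.inl v := dif_neg h
    rw [e]
    rfl

theorem isAcyclic_cut (h : ∀ s, ¬ Relation.TransGen (Arc F ps) s s) :
    (cut F ps hps).M.toModule.IsAcyclic := by
  refine fun s hs => h s (Relation.TransGen.mono (fun a b hab => ?_) s s hs)
  obtain ⟨v, hv, e⟩ := Circuit.occurs_rename.1 (Circuit.occurs_of_influences hab)
  rw [cutName] at e
  split at e
  · cases e
  · rename_i hn
    cases e
    exact ⟨hn, hv⟩

/-- If a module unfolds a network whose circuits have only essential variables, then cutting the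
automata in the image of the wiring leaves no cycle. -/
theorem exists_cut_of_eqBAN (hF : F.Essential) {m : ℕ} {ω : Wiring (Fin n) (Fin m)}
    {M : BoolModule (Fin n) (Fin m)} (hM : M.IsAcyclic) (h : (ω.apply M).EqBAN F.toBAN) :
    ∃ ps : List ℕ, ps.Pairwise (· < ·) ∧ (∀ j ∈ ps, j < n) ∧ ps.length ≤ m ∧
      ∀ s, ¬ Relation.TransGen (Arc F ps) s s := by
  have hsome : ∀ i, ∃ s, ω i = some s := fun i => by
    cases hi : ω i with
    | none => exact (h.1.false ⟨i, hi⟩).elim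
    | some s => exact ⟨s, rfl⟩
  choose f hf using hsome
  set A : Finset ℕ := Finset.univ.image fun i => (f i : ℕ) with hA
  refine ⟨A.sort (· ≤ ·), A.sortedLT_sort.pairwise, fun j hj => ?_, ?_, fun s hs => ?_⟩
  · rw [Finset.mem_sort, hA, Finset.mem_image] at hj
    obtain ⟨i, -, rfl⟩ := hj
    exact (f i).2
  · rw [Finset.length_sort]
    exact Finset.card_image_le.trans (by simp)
  · refine hM s (Relation.TransGen.mono (fun a t hat => ?_) s s hs)
    obtain ⟨ha, hocc⟩ := hat
    obtain ⟨x, y, hne, hxy⟩ := (hF t a).1 hocc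
    have hv : ∀ z : Fin n → Bool, M t (Sum.elim z (z ∘ f)) = F.toBAN t z := by
      intro z
      have := h.2 t (Sum.elim z fun i => (h.1.false i).elim)
      simp only [Sum.elim_inl] at this
      rw [← this, Wiring.apply]
      congr 1
      funext v
      rcases v with v | i
      · rfl
      · rw [Wiring.subst_of_eq_some (hf i)]
        rfl
    refine ⟨Sum.elim x (x ∘ f), Sum.elim y (y ∘ f), by rwa [hv, hv], ?_⟩
    rintro (r | i)
    · simpa using hxy r
    · have : f i ≠ a := by
        rintro rfl
        exact ha (by rw [Finset.mem_sort]; exact Finset.mem_image_of_mem _ (Finset.mem_univ i))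
      simpa using (hxy _).1 this

end Unfold

namespace Verifier

theorem count_true_eq_length_positions (l : List Bool) :
    l.count true = (positions l).length := by
  induction l using List.reverseRecOn with
  | nil => rfl
  | append_singleton l b ih => cases b <;> simp [positions_append, ih]

/-! ### The acyclicity test -/

section Acyclicity

variable {n : ℕ}

theorem circuitOk_iff {a : List Bool} {C : Circuit (Fin n)} :
    circuitOk a C = true ↔ ∀ v, C.Occurs v → a.getD v false = true := by
  rw [circuitOk, List.all_eq_true]
  refine ⟨fun h v hv => h _ hv, fun h G hG => ?_⟩
  cases G with
  | var v => exact h v hG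
  | _ => rfl

theorem getD_newBits_iff {F : BANCode n} {a l : List Bool} {t : Fin n} :
    (newBits a (List.ofFn F) l).getD t false = true ↔
      (t : ℕ) ∈ positions l ∨ ∀ v, (F t).Occurs v → a.getD v false = true := by
  rw [getD_newBits _ _ _ _ (by simp), Bool.or_eq_true, mem_positions, ← circuitOk_iff]
  simp

theorem acc_of_getD_iterate {F : BANCode n} {l : List Bool} (i : ℕ) (t : Fin n)
    (h : ((fun a => newBits a (List.ofFn F) l)^[i] l).getD t false = true) :
    (t : ℕ) ∈ positions l ∨ Acc (Arc F (positions l)) t := by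
  induction i generalizing t with
  | zero => exact Or.inl (mem_positions.2 h)
  | succ i ih =>
    rw [Function.iterate_succ_apply', getD_newBits_iff] at h
    refine h.imp id fun h => ⟨t, fun s hs => ?_⟩
    exact (ih s (h s hs.2)).resolve_left hs.1

/-- If all bits are set after some rounds, then the arcs form no cycle. -/
theorem not_transGen_arc {F : BANCode n} {l : List Bool} (i : ℕ)
    (h : ∀ t : Fin n, ((fun a => newBits a (List.ofFn F) l)^[i] l).getD t false = true)
    (s : Fin n) : ¬ Relation.TransGen (Arc F (positions l)) s s := by
  intro hs
  rcases acc_of_getD_iterate i s (h s) with hp | hacc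
  · obtain ⟨b, hb, -⟩ := Relation.TransGen.head'_iff.1 hs
    exact hb.1 hp
  · have irrefl : ∀ {r : Fin n → Fin n → Prop} {s : Fin n}, Acc r s → ¬ r s s := fun h =>
      Acc.rec (fun s _ ih hs => ih s hs hs) h
    exact irrefl hacc.transGen hs

/-- Without a cycle, the bit of an automaton is set as soon as there were more rounds than
automata with a path to it; hence `n` rounds set all bits. -/
theorem getD_iterate_of_acyclic {F : BANCode n} {l : List Bool}
    (h : ∀ s, ¬ Relation.TransGen (Arc F (positions l)) s s) (i : ℕ) (hi : n ≤ i) (t : Fin n) :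
    ((fun a => newBits a (List.ofFn F) l)^[i] l).getD t false = true := by
  classical
  let anc : Fin n → Finset (Fin n) := fun t =>
    Finset.univ.filter fun s => Relation.TransGen (Arc F (positions l)) s t
  have key : ∀ (i : ℕ) (t : Fin n), ((t : ℕ) ∈ positions l ∨ (anc t).card < i) →
      ((fun a => newBits a (List.ofFn F) l)^[i] l).getD t false = true := by
    intro i
    induction i with
    | zero => exact fun t ht => mem_positions.1 (ht.resolve_right (Nat.not_lt_zero _))
    | succ i ih =>
      intro t ht
      rw [Function.iterate_succ_apply', getD_newBits_iff]
      refine ht.imp id fun ht v hv => ih v ?_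
      by_cases hp : (v : ℕ) ∈ positions l
      · exact Or.inl hp
      · have harc : Arc F (positions l) v t := ⟨hp, hv⟩
        refine Or.inr (lt_of_lt_of_le (Finset.card_lt_card ?_) (Nat.lt_succ_iff.1 ht))
        refine Finset.ssubset_iff_subset_ne.2 ⟨fun s hs => ?_, fun e => ?_⟩
        · simp only [anc, Finset.mem_filter, Finset.mem_univ, true_and] at hs ⊢
          exact hs.tail harc
        · have : v ∈ anc t := by simpa [anc] using Relation.TransGen.single harc
          rw [← e] at this
          exact h v (by simpa [anc] using this)
  refine key i t (Or.inr (lt_of_lt_of_le ?_ hi))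
  refine (Finset.card_lt_univ_of_notMem (x := t) ?_).trans_eq (Fintype.card_fin n)
  simpa [anc] using h t

end Acyclicity

/-! ### What the verifier accepts -/

theorem idxOf_positions_le {l : List Bool} {j : ℕ} (h : j ∈ positions l) :
    (positions l).idxOf j ≤ j := by
  rw [idxOf_positions h]
  refine (List.length_filter_le _ _).trans ?_
  simp

theorem length_substName_le (l : List Bool) (v : ℕ) :
    (substName (positions l) v).length ≤ (Letter.auto :: encodeIdx v).length := by
  unfold substName
  split
  · rename_i h
    simpa [length_encodeIdx] using idxOf_positions_le h
  · exact le_rfl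

/-- The circuits of an instance, with the automata of a list replaced by inputs. -/
def cutWord (x : UnfoldingInstance) (ps : List ℕ) : List Letter :=
  encodeList (encodeCircuit fun v : Fin x.n => substName ps v) (List.ofFn x.F)

theorem length_cutWord_le (x : UnfoldingInstance) (l : List Bool) :
    (cutWord x (positions l)).length ≤ x.encode.length := by
  have : (cutWord x (positions l)).length ≤
      (encodeList (encodeCircuit encodeFin) (List.ofFn x.F)).length :=
    length_encodeList_le (e := encodeCircuit fun v : Fin x.n => substName (positions l) v)
      (fun C => length_encodeCircuit_le (fun v : Fin x.n => length_substName_le l v) C) _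
  simp only [UnfoldingInstance.encode, List.length_append]
  omega

theorem n_lt_length_encode (x : UnfoldingInstance) : x.n < x.encode.length := by
  simp only [UnfoldingInstance.encode, List.length_append, length_encodeIdx]
  omega

/-- The part of the verifier after the wiring has been read. -/
theorem eval_checks (x : UnfoldingInstance) (rest : List Letter) (l : List Bool) (N : ℕ)
    (hu : x.encode.length ≤ N) (hl : l.length ≤ N) (b : Bool) :
    (Cmd.eval N (ifOk <| .seq readSize <| ifOk <| .seq substitute <| .seq compare <|
      .seq relaxAll <| .seq count allSet)
      (⟨none, .done, true, b⟩,
        { W := word rest, U := word x.encode, V := bits l : Mem }.get)).1.ok =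
      (decide (l.length ≤ x.n) && (decide (rest = cutWord x (positions l)) &&
        (decide ((positions l).length ≤ x.k) &&
          ((fun a => newBits a (List.ofFn x.F) l)^[N] l).all id))) := by
  have hn := n_lt_length_encode x
  have hcut := length_cutWord_le x l
  have hx : x.encode = encodeIdx x.n ++ (encodeList (encodeCircuit encodeFin) (List.ofFn x.F) ++
    (Computability.encodeNat x.k).map Letter.bit) := rfl
  have hx' := congrArg List.length hx
  simp only [List.length_append, List.length_map] at hx'
  have hU' : (word (encodeList (encodeCircuit encodeFin) (List.ofFn x.F) ++
    (Computability.encodeNat x.k).map Letter.bit)).length ≤ N := by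
    rw [length_word]; simp only [List.length_append, List.length_map]; omega
  have hok : ∀ (c : Prog) (s : State), s.1.ok = true → Cmd.eval N (ifOk c) s = Cmd.eval N c s := by
    rintro c ⟨v, S⟩ h
    change v.ok = _ at h
    simp [ifOk, Cmd.eval, h]
  have hok' : ∀ (c : Prog) (s : State), s.1.ok = false → Cmd.eval N (ifOk c) s = s := by
    rintro c ⟨v, S⟩ h
    change v.ok = _ at h
    simp [ifOk, Cmd.eval, h, skip]
  rw [hok _ _ rfl, Cmd.eval, eval_readSize x.n _ l
    { W := word rest, U := word x.encode, V := bits l } N rfl rfl rfl rfl rfl hu hl]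
  by_cases hln : l.length ≤ x.n
  · have hd : bits (l.drop x.n) = [] := by rw [List.drop_eq_nil_of_le hln]; rfl
    rw [hok _ _ (by simpa using hln), hd, decide_eq_true hln, Bool.true_and]
    have hsub := eval_substitute (List.ofFn x.F) (Computability.encodeNat x.k) l N hl (by omega)
      { W := word rest, V := bits l, U := word (encodeList (encodeCircuit encodeFin)
          (List.ofFn x.F) ++ (Computability.encodeNat x.k).map Letter.bit) }
      rfl hU' rfl rfl rfl rfl rfl rfl rfl rfl .done true b
    obtain ⟨W', hc⟩ := eval_compare (cutWord x (positions l)) rest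
      { W := word rest, V := bits l, U := word (encodeList (encodeCircuit encodeFin)
          (List.ofFn x.F) ++ (Computability.encodeNat x.k).map Letter.bit)
        Y := (word (cutWord x (positions l))).reverse
        K := (bits (Computability.encodeNat x.k)).reverse } N (by omega) rfl rfl rfl .outer true b
    have hlF : l.length ≤ (List.ofFn x.F).length := by simpa using hln
    have hFN : (List.ofFn x.F).length ≤ N := by simp; omega
    obtain ⟨o₁, b₁, hr⟩ := eval_relaxAll (List.ofFn x.F) (Computability.encodeNat x.k) l N hlF hFN
      { W := W', V := bits l, U := word (encodeList (encodeCircuit encodeFin)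
          (List.ofFn x.F) ++ (Computability.encodeNat x.k).map Letter.bit)
        K := (bits (Computability.encodeNat x.k)).reverse }
      rfl hU' rfl rfl rfl rfl rfl rfl rfl .outer (true && decide (rest = cutWord x (positions l))) b
    have hlen : ((fun a => newBits a (List.ofFn x.F) l)^[N] l).length ≤ N := by
      obtain ⟨i, rfl⟩ : ∃ i, N = i + 1 := ⟨N - 1, by omega⟩
      rw [Function.iterate_succ_apply', length_newBits]
      exact hFN
    obtain ⟨o₂, y, hk⟩ := eval_count (Computability.encodeNat x.k) l N (by omega) hl
      { W := W', V := bits l, U := word (encodeList (encodeCircuit encodeFin)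
          (List.ofFn x.F) ++ (Computability.encodeNat x.k).map Letter.bit)
        K := (bits (Computability.encodeNat x.k)).reverse
        A := bits ((fun a => newBits a (List.ofFn x.F) l)^[N] l) }
      rfl rfl rfl rfl o₁ (true && decide (rest = cutWord x (positions l))) b₁
    refine (congrArg (fun s : State =>
      (Cmd.eval N (.seq compare <| .seq relaxAll <| .seq count allSet) s).1.ok) hsub).trans ?_
    refine (congrArg (fun s : State =>
      (Cmd.eval N (.seq relaxAll <| .seq count allSet) s).1.ok) hc).trans ?_
    refine (congrArg (fun s : State => (Cmd.eval N (.seq count allSet) s).1.ok) hr).trans ?_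
    refine (congrArg (fun s : State => (Cmd.eval N allSet s).1.ok) hk).trans ?_
    rw [eval_allSet _ N hlen _ rfl, value_encodeNat, count_true_eq_length_positions,
      Bool.true_and, Bool.and_assoc]
  · rw [hok' _ _ (by simpa using hln)]
    simp [hln]

theorem accepts_encode (x : UnfoldingInstance) (w : List Letter) :
    ∃ s : State, accepts (x.encode, w) = (Cmd.eval (pairCode (x.encode, w)).length
        (ifOk <| .seq readSize <| ifOk <| .seq substitute <| .seq compare <|
          .seq relaxAll <| .seq count allSet) s).1.ok ∧
      s = readWiring.eval (pairCode (x.encode, w)).length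
        (⟨none, .done, true, false⟩, { W := word w, U := word x.encode : Mem }.get) := by
  refine ⟨_, ?_, rfl⟩
  rw [accepts, verifier, Cmd.eval, eval_splitInput _ _ _ le_rfl, Cmd.eval]

theorem length_pairCode {Γ : Type} (u w : List Γ) :
    (pairCode (u, w)).length = u.length + (w.length + 1) := by
  simp [pairCode]

/-- An accepted word consists of a list of automata and of the circuits with these automata
replaced by inputs; the list is short and meets all cycles. -/
theorem exists_of_accepts {x : UnfoldingInstance} {w : List Letter}
    (h : accepts (x.encode, w) = true) : ∃ ps : List ℕ, (∀ j ∈ ps, j < x.n) ∧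
      w = entries ps ++ .nil :: cutWord x ps ∧ ps.length ≤ x.k ∧
      ∀ s, ¬ Relation.TransGen (Arc x.F ps) s s := by
  obtain ⟨s, hs, hrun⟩ := accepts_encode x w
  rw [h] at hs
  have hN := length_pairCode x.encode w
  obtain ⟨-, hw⟩ := eval_readWiring w (pairCode (x.encode, w)).length (by omega)
    { W := word w, U := word x.encode } rfl rfl rfl rfl rfl rfl .done true false
  rw [← hrun] at hw
  have hsok : s.1.ok = true := by
    by_contra hn
    obtain ⟨v, S⟩ := s
    simp only [Bool.not_eq_true] at hn
    simp [ifOk, Cmd.eval, hn, skip] at hs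
  obtain ⟨l, rest, hl, -, rfl, e⟩ := hw hsok
  have hs' := hs
  rw [e] at hs'
  have hc := eval_checks x rest l
    (pairCode (x.encode, entries (positions l) ++ .nil :: rest)).length (by omega) (by omega) false
  have hs'' := hs'.trans hc
  symm at hs''
  simp only [Bool.and_eq_true, decide_eq_true_eq] at hs''
  obtain ⟨hln, rfl, hk, hall⟩ := hs''
  refine ⟨positions l, fun j hj => (lt_of_mem_positions hj).trans_le hln, rfl, hk, ?_⟩
  refine not_transGen_arc (pairCode (x.encode,
    entries (positions l) ++ .nil :: cutWord x (positions l))).length fun t => ?_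
  rw [List.all_eq_true] at hall
  have hlen : (t : ℕ) < ((fun a => newBits a (List.ofFn x.F) l)^[(pairCode (x.encode,
      entries (positions l) ++ .nil :: cutWord x (positions l))).length] l).length := by
    rw [hN, ← Nat.add_assoc, Function.iterate_succ_apply', length_newBits]
    simp
  rw [List.getD_eq_getElem _ _ hlen]
  exact hall _ (List.getElem_mem hlen)

theorem accepts_of_acyclic {x : UnfoldingInstance} {ps : List ℕ} (hsort : ps.Pairwise (· < ·))
    (hps : ∀ j ∈ ps, j < x.n) (hk : ps.length ≤ x.k)
    (hcyc : ∀ s, ¬ Relation.TransGen (Arc x.F ps) s s) :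
    accepts (x.encode, entries ps ++ .nil :: cutWord x ps) = true ∧
      (cutWord x ps).length ≤ x.encode.length := by
  obtain ⟨s, hs, hrun⟩ := accepts_encode x (entries ps ++ .nil :: cutWord x ps)
  rw [hs]
  clear hs
  have hN := length_pairCode x.encode (entries ps ++ .nil :: cutWord x ps)
  generalize (pairCode (x.encode, entries ps ++ .nil :: cutWord x ps)).length = N at *
  have hok := readWiring_entries ps hsort (cutWord x ps) N
    { W := word (entries ps ++ .nil :: cutWord x ps), U := word x.encode } rfl rfl rfl rfl rfl rfl
    (by omega) .done true false
  obtain ⟨l, rest, hl, ht, hw, e⟩ := (eval_readWiring (entries ps ++ .nil :: cutWord x ps) N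
    (by omega) { W := word (entries ps ++ .nil :: cutWord x ps), U := word x.encode }
    rfl rfl rfl rfl rfl rfl .done true false).2 hok
  have hcode : PrefixCode fun j => Letter.auto :: encodeIdx j := fun a b r s h => by
    simp only [List.cons_append, List.cons.injEq, true_and] at h
    exact prefixCode_encodeIdx _ _ _ _ h
  obtain ⟨rfl, rfl⟩ := prefixCode_encodeList hcode ps (positions l) (cutWord x ps) rest (by
    rw [encodeList_eq_entries, encodeList_eq_entries]
    simpa using hw)
  refine ⟨?_, length_cutWord_le x l⟩
  rw [hrun, e]
  have hln : l.length ≤ x.n := ht _ hps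
  have hnN := n_lt_length_encode x
  refine (eval_checks x _ l N (by omega) (by omega) false).trans ?_
  simp only [Bool.and_eq_true, decide_eq_true_eq]
  refine ⟨hln, trivial, hk, ?_⟩
  rw [List.all_eq_true]
  intro b hb
  obtain ⟨i, hi, rfl⟩ := List.getElem_of_mem hb
  have hi' : i < x.n := by
    obtain ⟨j, rfl⟩ : ∃ j, N = j + 1 := ⟨N - 1, by omega⟩
    rw [Function.iterate_succ_apply', length_newBits, List.length_ofFn] at hi
    exact hi
  have := getD_iterate_of_acyclic hcyc N (by omega) ⟨i, hi'⟩
  rwa [List.getD_eq_getElem _ _ hi] at this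

theorem length_entries_le {ps : List ℕ} {n : ℕ} (hps : ∀ j ∈ ps, j < n) :
    (entries ps).length ≤ ps.length * (n + 2) := by
  induction ps with
  | nil => simp [entries]
  | cons j ps ih =>
    have h1 := ih fun i hi => hps i (List.mem_cons_of_mem _ hi)
    have h2 := hps j List.mem_cons_self
    have h3 : entries (j :: ps) = Letter.cons :: Letter.auto :: (encodeIdx j ++ entries ps) := by
      simp [entries]
    rw [h3]
    simp only [List.length_cons, List.length_append, length_encodeIdx, Nat.add_mul]
    omega

theorem length_le_of_pairwise_lt {ps : List ℕ} {n : ℕ} (hsort : ps.Pairwise (· < ·))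
    (hps : ∀ j ∈ ps, j < n) : ps.length ≤ n := by
  have hnd : ps.Nodup := hsort.imp fun h => h.ne
  rw [← List.toFinset_card_of_nodup hnd, ← Finset.card_range n]
  exact Finset.card_le_card fun j hj => Finset.mem_range.2 (hps j (by simpa using hj))

end Verifier

/-! ### The problems are in FNP -/

theorem exists_solution_of_accepts {x : UnfoldingInstance} {w : List Letter}
    (h : Verifier.accepts (x.encode, w) = true) : ∃ y : UnfoldingCandidate x.n,
      y.encode = w ∧ syntacticAcyclicUnfolding.IsSolution x y := by
  obtain ⟨ps, hps, rfl, hk, hcyc⟩ := Verifier.exists_of_accepts h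
  exact ⟨cut x.F ps hps, encode_cut, isAcyclic_cut hcyc, hk, syntacticEq_cut⟩

theorem isSolution_of_syntactic {x : UnfoldingInstance} {y : UnfoldingCandidate x.n}
    (h : syntacticAcyclicUnfolding.IsSolution x y) : acyclicUnfolding.IsSolution x y :=
  ⟨h.1, h.2.1, h.2.2.eqBAN⟩

/-- The bound on the length of certificates. -/
noncomputable def certificateBound : Polynomial ℕ :=
  Polynomial.X * (Polynomial.X + 2) + 1 + Polynomial.X

theorem exists_accepts_of_solution {x : UnfoldingInstance} (hF : x.F.Essential)
    {y : UnfoldingCandidate x.n} (hy : acyclicUnfolding.IsSolution x y) : ∃ w : List Letter,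
      w.length ≤ certificateBound.eval x.encode.length ∧
      Verifier.accepts (x.encode, w) = true := by
  obtain ⟨hM, hk, hE⟩ := hy
  obtain ⟨ps, hsort, hps, hlen, hcyc⟩ := exists_cut_of_eqBAN hF hM hE
  obtain ⟨hacc, hcut⟩ := Verifier.accepts_of_acyclic hsort hps (hlen.trans hk) hcyc
  refine ⟨_, ?_, hacc⟩
  have hn := Verifier.n_lt_length_encode x
  have h1 := Verifier.length_entries_le hps
  have h2 := Verifier.length_le_of_pairwise_lt hsort hps
  have h3 : ps.length * (x.n + 2) ≤ x.encode.length * (x.encode.length + 2) :=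
    Nat.mul_le_mul (by omega) (by omega)
  have h4 : certificateBound.eval x.encode.length =
      x.encode.length * (x.encode.length + 2) + 1 + x.encode.length := by
    simp [certificateBound]
  rw [h4, List.length_append, List.length_cons]
  omega

theorem mainTheorem4 :
    acyclicUnfolding.InFNP ∧ syntacticAcyclicUnfolding.InFNP ∧
    ∀ x : UnfoldingInstance,
      (∀ y : UnfoldingCandidate x.n,
        syntacticAcyclicUnfolding.IsSolution x y → acyclicUnfolding.IsSolution x y) ∧
      (x.F.Essential →
        (∃ y : UnfoldingCandidate x.n, acyclicUnfolding.IsSolution x y) →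
        ∃ y : UnfoldingCandidate x.n, syntacticAcyclicUnfolding.IsSolution x y) := by
  refine ⟨⟨Verifier.accepts, certificateBound, Verifier.polyTimeDecides_accepts, fun x hx =>
    ⟨fun w _ hw => ?_, ?_⟩⟩, ⟨Verifier.accepts, certificateBound,
    Verifier.polyTimeDecides_accepts, fun x hx => ⟨fun w _ hw => ?_, ?_⟩⟩,
    fun x => ⟨fun y hy => isSolution_of_syntactic hy, fun hF ⟨y, hy⟩ => ?_⟩⟩
  · obtain ⟨y, rfl, hy⟩ := exists_solution_of_accepts hw
    exact ⟨y, rfl, isSolution_of_syntactic hy⟩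
  · rintro ⟨y, hy⟩
    exact exists_accepts_of_solution hx hy
  · exact exists_solution_of_accepts hw
  · rintro ⟨y, hy⟩
    exact exists_accepts_of_solution hx (isSolution_of_syntactic hy)
  · obtain ⟨w, -, hw⟩ := exists_accepts_of_solution hF hy
    obtain ⟨z, -, hz⟩ := exists_solution_of_accepts hw
    exact ⟨z, hz⟩
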